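/- Let $n\ge 1$ and $m\ge 0$ be integers, let $0<\alpha\le 2$, and put $s:=m+\frac{\alpha}{2}$. Assume $0<s<\frac n2$, $0<\sigma<n$, $0<p\le\frac{2n-\sigma}{n-2s}$ and $0<q\le\frac{n+2s-\sigma}{n-2s}$. Let $R_{2s,n}:=\frac{\Gamma\left(\frac{n-2s}{2}\right)}{\pi^{n/2}\,2^{2s}\,\Gamma(s)}$, and consider continuous functions $u:\mathbb{R}^n\to[0,\infty)$ that satisfy, for every $x\in\mathbb{R}^n$, the integral equation $$u(x)=\int_{\mathbb{R}^n}\frac{R_{2s,n}}{|x-y|^{n-2s}}\left(\int_{\mathbb{R}^n}\frac{u(z)^p}{|y-z|^{\sigma}}\,dz\right)u(y)^q\,dy \qquad (\ast)$$ (Lebesgue integrals of nonnegative functions, with values in $[0,\infty]$). (i) If $p=\frac{2n-\sigma}{n-2s}$ and $q=\frac{n+2s-\sigma}{n-2s}$, then every continuous nonnegative solution $u$ of $(\ast)$ is either identically $0$ or of the form $$u(x)=\mu^{\frac{n-2s}{2}}\,Q\big(\mu(x-x_0)\big)\qquad (x\in\mathbb{R}^n)$$ for some $\mu>0$ and $x_0\in\mathbb{R}^n$,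 where $$Q(x)=\left(\frac{1}{R_{2s,n}\,I\left(\frac{\sigma}{2}\right)I\left(\frac{n-2s}{2}\right)}\right)^{\frac{n-2s}{2(n+2s-\sigma)}}\left(\frac{1}{1+|x|^2}\right)^{\frac{n-2s}{2}},\qquad I(\gamma):=\frac{\pi^{n/2}\,\Gamma\left(\frac{n-2\gamma}{2}\right)}{\Gamma(n-\gamma)}\quad\left(0<\gamma<\tfrac n2\right).$$ (ii) If $p<\frac{2n-\sigma}{n-2s}$ or $q<\frac{n+2s-\sigma}{n-2s}$, then $u\equiv 0$ is the unique continuous nonnegative solution of $(\ast)$. -/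

import Mathlib

open MeasureTheory
open scoped ENNReal

noncomputable section

/-- The Riesz potential constant
`R_{γ,n} = Γ((n-γ)/2) / (π^{n/2} 2^γ Γ(γ/2))`, for `0 < γ < n`. -/
def rieszConst (γ : ℝ) (n : ℕ) : ℝ :=
  Real.Gamma (((n : ℝ) - γ) / 2) /
    (Real.pi ^ ((n : ℝ) / 2) * (2 : ℝ) ^ γ * Real.Gamma (γ / 2))

/-- The constant `I(γ) = π^{n/2} Γ((n-2γ)/2) / Γ(n-γ)`, for `0 < γ < n/2`. -/
def bubbleI (n : ℕ) (γ : ℝ) : ℝ :=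
  Real.pi ^ ((n : ℝ) / 2) * Real.Gamma (((n : ℝ) - 2 * γ) / 2) / Real.Gamma ((n : ℝ) - γ)

/-- The profile
`Q(x) = (1 / (R_{2s,n} I(σ/2) I((n-2s)/2)))^{(n-2s)/(2(n+2s-σ))} (1/(1+|x|²))^{(n-2s)/2}`. -/
def bubbleQ (n : ℕ) (s σ : ℝ) (x : EuclideanSpace ℝ (Fin n)) : ℝ :=
  (1 / (rieszConst (2 * s) n * bubbleI n (σ / 2) * bubbleI n (((n : ℝ) - 2 * s) / 2))) ^
      (((n : ℝ) - 2 * s) / (2 * ((n : ℝ) + 2 * s - σ))) *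
    (1 / (1 + ‖x‖ ^ 2)) ^ (((n : ℝ) - 2 * s) / 2)

/-- The convolution `(|·|^{-σ} * u^p)(y) = ∫ u(z)^p / |y-z|^σ dz` of a nonnegative function `u`,
as a Lebesgue integral with values in `[0,∞]`. -/
def hartreePotential {n : ℕ} (σ p : ℝ) (u : EuclideanSpace ℝ (Fin n) → ℝ)
    (y : EuclideanSpace ℝ (Fin n)) : ℝ≥0∞ :=
  ∫⁻ z, ENNReal.ofReal (1 / ‖y - z‖ ^ σ * u z ^ p)

/-- `u` is a nonnegative solution of the integral equation
`u(x) = ∫ R_{2s,n} / |x-y|^{n-2s} (∫ u(z)^p / |y-z|^σ dz) u(y)^q dy`, for every `x ∈ ℝⁿ`.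
All integrands are nonnegative, so the integrals are Lebesgue integrals with values in `[0,∞]`;
the equation itself forces the right-hand side to be finite. -/
structure IsNonnegSolution {n : ℕ} (s σ p q : ℝ) (u : EuclideanSpace ℝ (Fin n) → ℝ) : Prop where
  nonneg : ∀ x, 0 ≤ u x
  eq_integral : ∀ x, ENNReal.ofReal (u x) =
    ∫⁻ y, ENNReal.ofReal (rieszConst (2 * s) n / ‖x - y‖ ^ ((n : ℝ) - 2 * s)) *
      hartreePotential σ p u y * ENNReal.ofReal (u y ^ q)

end

/-!
The theorem is proved by the method of moving spheres, in integral form.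

A nontrivial solution `u` is positive, and with `v = |·|^{-σ} * u^p` it solves the system
`v = |·|^{-σ} * u^p`, `u = R |·|^{-ν} * (v u^q)`, where `ν = n - 2s`. For a sphere of centre `c` and
radius `λ` let `u'` and `v'` be the Kelvin transforms of `u` and `v` of weights `ν` and `σ`. A Riesz
potential `P = |·|^{-κ} * w` and its Kelvin transform of weight `κ` satisfy, in the ball,
`P' - P = ∫_ball (G - H) (w' - w)`, with `w'` the Kelvin transform of `w` of weight `2n - κ`, `G` the
Riesz kernel and `H < G` its reflection. Because the exponents are at most critical, `u ≤ u'` in the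
ball gives `v ≤ v'` there, and if then `u` and `u'` agree at one point, both exponents are critical
and `u = u'` in the ball (`HartreeSystem.eq_kelvin_of_touch`). The same formula gives a maximum
principle in regions of small measure (`HartreeSystem.exists_narrow`): the supremum of `u - u'` is
halved by the two integral inequalities. No regularity of `u` beyond continuity is involved, and a
lower bound for `u'` in the ball makes the powers Lipschitz even for exponents below one.

Consequently the radii `λ` with `u ≤ u'` in the ball form a nonempty open and closed subset of
`(0, ∞)`, unless the exponents are critical and `u = u'` for some `λ`
(`HartreeSystem.le_kelvin_or_eq_kelvin`). If `u ≤ u'` held for all centres and radii, then `u` would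
be constant (`le_of_forall_le_kelvin`) and `v` infinite. This settles the subcritical case. In the
critical case one sphere of symmetry bounds `|x|^ν u(x)` at infinity, which produces a sphere of
symmetry around every point (`HartreeSystem.exists_eq_kelvin`).

The squared radius `f(c)` of the sphere of symmetry around `c` is a constant multiple of
`u(c)^{-2/ν}`, so `f` is continuous and satisfies `f(a) f(b) = |b - a|² f(b*)`, where `b*` is the
inverse point of `b` in the sphere around `a`. The solutions of this functional equation are
`d + |x - m|²` (`eq_norm_sub_sq_add_of_inversion_invariant`), so `u` is a multiple of
`(d + |x - m|²)^{-ν/2}`. The multiple is found from the Riesz potentials of such functions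
(`rieszPot_bubble`), which are evaluated by one more inversion and a Gaussian integral.
-/

/-! ### Change of variables by inversion -/

section Inversion

open Set Metric EuclideanGeometry

variable {n : ℕ}

lemma lintegral_image_inversion {c : EuclideanSpace ℝ (Fin n)} {lam : ℝ} (hlam : 0 < lam)
    {S : Set (EuclideanSpace ℝ (Fin n))} (hS : MeasurableSet S) (hc : c ∉ S)
    (f : EuclideanSpace ℝ (Fin n) → ℝ≥0∞) :
    ∫⁻ y in inversion c lam '' S, f y =
      ∫⁻ y in S, ENNReal.ofReal ((lam / dist y c) ^ (2 * n)) * f (inversion c lam y) := by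
  have hne : ∀ y ∈ S, y ≠ c := fun y hy h => hc (h ▸ hy)
  rw [lintegral_image_eq_lintegral_abs_det_fderiv_mul volume hS
    (fun y hy => (hasFDerivAt_inversion (hne y hy)).hasFDerivWithinAt)
    (inversion_injective c hlam.ne').injOn]
  refine setLIntegral_congr_fun hS fun y hy => ?_
  have h1 : |((Submodule.reflection (ℝ ∙ (y - c))ᗮ : EuclideanSpace ℝ (Fin n) →L[ℝ]
      EuclideanSpace ℝ (Fin n))).det| = 1 := by
    have := Submodule.det_reflection (𝕜 := ℝ) (ℝ ∙ (y - c))ᗮ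
    have h2 : (Submodule.reflection (ℝ ∙ (y - c))ᗮ : EuclideanSpace ℝ (Fin n) →L[ℝ]
      EuclideanSpace ℝ (Fin n)).det = (-1) ^ Module.finrank ℝ ((ℝ ∙ (y - c))ᗮ)ᗮ := this
    rw [h2, abs_pow, abs_neg, abs_one, one_pow]
  rw [ContinuousLinearMap.det, ContinuousLinearMap.toLinearMap_smul, LinearMap.det_smul, abs_mul]
  rw [ContinuousLinearMap.det] at h1
  rw [h1, mul_one, finrank_euclideanSpace_fin, ← pow_mul, abs_of_nonneg (by positivity)]

lemma inversion_image_punctured_ball {c : EuclideanSpace ℝ (Fin n)} {lam : ℝ} (hlam : 0 < lam) :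
    inversion c lam '' (ball c lam \ {c}) = (closedBall c lam)ᶜ := by
  ext x
  constructor
  · rintro ⟨y, ⟨hy, hyc⟩, rfl⟩
    have hd : 0 < dist y c := dist_pos.2 hyc
    have : dist y c < lam := hy
    simp only [mem_compl_iff, mem_closedBall, not_le, dist_inversion_center]
    rw [lt_div_iff₀ hd]; nlinarith
  · intro hx
    have hx' : lam < dist x c := by simpa using hx
    have hd : 0 < dist x c := hlam.trans hx'
    refine ⟨inversion c lam x, ⟨?_, ?_⟩, inversion_inversion c hlam.ne' x⟩
    · rw [mem_ball, dist_inversion_center, div_lt_iff₀ hd]; nlinarith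
    · rw [mem_singleton_iff, inversion_eq_center hlam.ne']
      exact dist_pos.1 hd

lemma inversion_image_compl_singleton {c : EuclideanSpace ℝ (Fin n)} {lam : ℝ} (hlam : 0 < lam) :
    inversion c lam '' {c}ᶜ = {c}ᶜ := by
  rw [image_compl_eq (inversion_bijective c hlam.ne')]; simp

/-- An integral over the space, with the exterior of a ball folded into the ball by inversion. -/
lemma lintegral_split_inversion [Nonempty (Fin n)] {c : EuclideanSpace ℝ (Fin n)} {lam : ℝ}
    (hlam : 0 < lam) (f : EuclideanSpace ℝ (Fin n) → ℝ≥0∞) :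
    ∫⁻ y, f y = (∫⁻ y in ball c lam \ {c}, f y) + ∫⁻ y in ball c lam \ {c},
      ENNReal.ofReal ((lam / dist y c) ^ (2 * n)) * f (inversion c lam y) := by
  have hz : volume ({c} : Set (EuclideanSpace ℝ (Fin n))) = 0 := measure_singleton c
  rw [← lintegral_image_inversion hlam (S := ball c lam \ {c})
    (measurableSet_ball.diff (measurableSet_singleton c)) (fun h => h.2 rfl) f,
    inversion_image_punctured_ball hlam, setLIntegral_congr (sdiff_null_ae_eq_self hz),
    ← lintegral_add_compl f measurableSet_closedBall]
  congr 1
  rw [← closedBall_sdiff_sphere, setLIntegral_congr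
    (sdiff_null_ae_eq_self (Measure.addHaar_sphere volume c lam))]

lemma lintegral_inversion [Nonempty (Fin n)] {c : EuclideanSpace ℝ (Fin n)} {lam : ℝ}
    (hlam : 0 < lam) (f : EuclideanSpace ℝ (Fin n) → ℝ≥0∞) :
    ∫⁻ y, f y = ∫⁻ y, ENNReal.ofReal ((lam / dist y c) ^ (2 * n)) * f (inversion c lam y) := by
  have h1 := lintegral_image_inversion hlam (S := {c}ᶜ)
    (measurableSet_singleton c).compl (fun h => h rfl) f
  rw [inversion_image_compl_singleton hlam, restrict_compl_singleton] at h1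
  exact h1

end Inversion

/-! ### Integrals of the Riesz kernel -/

section Kernel

open Set Metric

variable {n : ℕ}

lemma lintegral_ball_norm_rpow_lt_top [Nonempty (Fin n)] {κ : ℝ} (hκ : κ < n) (r : ℝ) :
    ∫⁻ z in ball (0 : EuclideanSpace ℝ (Fin n)) r, ENNReal.ofReal (‖z‖ ^ (-κ)) < ∞ := by
  have h : IntegrableOn (fun z : EuclideanSpace ℝ (Fin n) => ‖z‖ ^ (-κ)) (ball 0 r) := by
    rw [integrableOn_fun_norm_addHaar volume (f := fun t => t ^ (-κ))]
    have hn : 1 ≤ n := Fin.pos (Classical.arbitrary (Fin n))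
    rcases le_or_gt r 0 with hr | hr
    · simp [Ioo_eq_empty_of_le hr]
    refine ((intervalIntegral.integrableOn_Ioo_rpow_iff (s := n - 1 - κ) hr).2
      (by linarith)).congr_fun (fun t ht => ?_) measurableSet_Ioo
    rw [finrank_euclideanSpace_fin, smul_eq_mul, ← Real.rpow_natCast, ← Real.rpow_add ht.1]
    rw [Nat.cast_sub hn]; push_cast; ring_nf
  exact h.lintegral_lt_top

lemma lintegral_ball_norm_sub_rpow_le {κ : ℝ} (c x : EuclideanSpace ℝ (Fin n)) (r ρ : ℝ)
    (h : r + dist x c ≤ ρ) :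
    ∫⁻ z in ball c r, ENNReal.ofReal (‖x - z‖ ^ (-κ)) ≤
      ∫⁻ z in ball (0 : EuclideanSpace ℝ (Fin n)) ρ, ENNReal.ofReal (‖z‖ ^ (-κ)) := by
  rw [← lintegral_indicator measurableSet_ball, ← lintegral_indicator measurableSet_ball,
    ← lintegral_sub_left_eq_self _ x]
  refine lintegral_mono fun z => ?_
  by_cases hz : x - z ∈ ball c r
  · have : z ∈ ball (0 : EuclideanSpace ℝ (Fin n)) ρ := by
      rw [mem_ball_zero_iff]
      have h1 : ‖z‖ = dist x (x - z) := by rw [dist_eq_norm, sub_sub_cancel]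
      have h2 := dist_triangle_right x (x - z) c
      rw [mem_ball] at hz
      linarith
    rw [indicator_of_mem hz, indicator_of_mem this, sub_sub_cancel]
  · rw [indicator_of_notMem hz]
    exact zero_le

/-- Uniformly in the pole `x`, the integral of the Riesz kernel over a subset of a fixed ball is
small with the measure of the subset. -/
lemma exists_setLIntegral_kernel_le [Nonempty (Fin n)] {κ : ℝ} (hκ : κ < n) (c : EuclideanSpace ℝ (Fin n)) (L : ℝ)
    {ε : ℝ} (hε : 0 < ε) :
    ∃ δ : ℝ≥0∞, 0 < δ ∧ ∀ N : Set (EuclideanSpace ℝ (Fin n)), MeasurableSet N → N ⊆ ball c L →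
      volume N < δ → ∀ x ∈ ball c L,
        ∫⁻ z in N, ENNReal.ofReal (‖x - z‖ ^ (-κ)) ≤ ENNReal.ofReal ε := by
  have hfin := lintegral_ball_norm_rpow_lt_top hκ (2 * L)
  obtain ⟨δ, hδ, H⟩ := exists_pos_setLIntegral_lt_of_measure_lt hfin.ne
    (ENNReal.ofReal_pos.2 hε).ne'
  refine ⟨δ, hδ, fun N hN hNB hvol x hx => ?_⟩
  have hmeas : MeasurableSet ((fun z => x - z) ⁻¹' N) := (measurable_const.sub measurable_id) hN
  have hsub : (fun z => x - z) ⁻¹' N ⊆ ball 0 (2 * L) := by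
    intro z hz
    have h1 : dist (x - z) c < L := hNB hz
    have h2 : dist x c < L := hx
    rw [mem_ball_zero_iff]
    calc ‖z‖ = dist x (x - z) := by rw [dist_eq_norm, sub_sub_cancel]
      _ ≤ dist x c + dist (x - z) c := dist_triangle_right _ _ _
      _ < 2 * L := by linarith
  have hv : volume ((fun z => x - z) ⁻¹' N) = volume N :=
    (Measure.measurePreserving_sub_left volume x).measure_preimage hN.nullMeasurableSet
  have := H _ (lt_of_le_of_lt ((Measure.restrict_apply_le _ _).trans hv.le) hvol)
  rw [Measure.restrict_restrict hmeas, inter_eq_left.2 hsub] at this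
  refine le_trans (le_of_eq ?_) this.le
  rw [← lintegral_indicator hN, ← lintegral_indicator hmeas, ← lintegral_sub_left_eq_self _ x]
  refine lintegral_congr fun z => ?_
  simp only [indicator, sub_sub_cancel, mem_preimage]
  rfl

lemma lintegral_norm_sub_rpow_eq_top [Nonempty (Fin n)] {σ : ℝ} (hσ : σ < n) (hσ₀ : 0 < σ)
    (x : EuclideanSpace ℝ (Fin n)) :
    ∫⁻ z, ENNReal.ofReal (‖x - z‖ ^ (-σ)) = ∞ := by
  -- On the ball of radius `r` the integrand is at least `r ^ (-σ)`.
  have key : ∀ r : ℝ, 0 < r → ENNReal.ofReal (r ^ (n - σ)) *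
      volume (ball (0 : EuclideanSpace ℝ (Fin n)) 1) ≤ ∫⁻ z, ENNReal.ofReal (‖x - z‖ ^ (-σ)) := by
    intro r hr
    have hz : volume ({x} : Set (EuclideanSpace ℝ (Fin n))) = 0 := measure_singleton x
    calc ENNReal.ofReal (r ^ (n - σ)) * volume (ball (0 : EuclideanSpace ℝ (Fin n)) 1)
        = ENNReal.ofReal (r ^ (-σ)) * volume (ball x r) := by
          rw [Measure.addHaar_ball _ _ hr.le, finrank_euclideanSpace_fin, ← mul_assoc,
            ← ENNReal.ofReal_mul (by positivity), ← Real.rpow_natCast, ← Real.rpow_add hr]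
          rw [show -σ + (n : ℝ) = n - σ by ring]
      _ = ∫⁻ z in ball x r \ {x}, ENNReal.ofReal (r ^ (-σ)) := by
          rw [setLIntegral_congr (sdiff_null_ae_eq_self hz)]; simp
      _ ≤ ∫⁻ z in ball x r \ {x}, ENNReal.ofReal (‖x - z‖ ^ (-σ)) := by
          refine setLIntegral_mono' (measurableSet_ball.diff (measurableSet_singleton x))
            fun z hz => ENNReal.ofReal_le_ofReal ?_
          have h1 : ‖x - z‖ < r := by rw [← dist_eq_norm, dist_comm]; exact hz.1
          exact Real.rpow_le_rpow_of_nonpos (norm_pos_iff.2 (sub_ne_zero.2 (Ne.symm hz.2))) h1.le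
            (by linarith)
      _ ≤ _ := setLIntegral_le_lintegral _ _
  by_contra hne
  have h0 : volume (ball (0 : EuclideanSpace ℝ (Fin n)) 1) ≠ 0 := (measure_ball_pos _ _ one_pos).ne'
  have h0' : volume (ball (0 : EuclideanSpace ℝ (Fin n)) 1) ≠ ∞ := measure_ball_lt_top.ne
  have hlim : Filter.Tendsto (fun r : ℝ => ENNReal.ofReal (r ^ (n - σ)) *
      volume (ball (0 : EuclideanSpace ℝ (Fin n)) 1)) Filter.atTop (nhds ∞) := by
    have := ENNReal.Tendsto.mul_const (b := volume (ball (0 : EuclideanSpace ℝ (Fin n)) 1))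
      (ENNReal.tendsto_ofReal_atTop.comp (tendsto_rpow_atTop (show 0 < n - σ by linarith)))
      (Or.inl (by simp))
    rwa [ENNReal.top_mul h0] at this
  have := le_of_tendsto hlim ((Filter.eventually_gt_atTop 0).mono key)
  exact hne (top_le_iff.1 this)

end Kernel

/-! ### Kelvin transforms of Riesz potentials -/

section KelvinTransform

open Set Metric EuclideanGeometry

variable {n : ℕ}

/-- The Riesz potential `∫ |x - y|^{-κ} w(y) dy` of a nonnegative density `w`, without its
normalising constant. -/
noncomputable def rieszPot (κ : ℝ) (w : EuclideanSpace ℝ (Fin n) → ℝ) (x : EuclideanSpace ℝ (Fin n)) : ℝ≥0∞ :=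
  ∫⁻ y, ENNReal.ofReal (‖x - y‖ ^ (-κ) * w y)

/-- The Kelvin transform of weight `κ` with respect to the sphere of centre `c` and radius `lam`.
At `c` it takes the junk value of a division by zero; statements about it are restricted to
punctured balls. -/
noncomputable def kelvin (c : EuclideanSpace ℝ (Fin n)) (lam κ : ℝ) (f : EuclideanSpace ℝ (Fin n) → ℝ)
    (x : EuclideanSpace ℝ (Fin n)) : ℝ :=
  (lam / dist x c) ^ κ * f (inversion c lam x)

/-- The reflection `(|y - c| |x - y*| / lam)^{-κ}` of the kernel `|x - y|^{-κ}` in the sphere of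
centre `c` and radius `lam`, where `y*` is the inverse point of `y`. -/
noncomputable def reflKernel (c : EuclideanSpace ℝ (Fin n)) (lam κ : ℝ) (x y : EuclideanSpace ℝ (Fin n)) : ℝ :=
  (dist y c * dist x (inversion c lam y) / lam) ^ (-κ)

lemma kelvin_nonneg {c : EuclideanSpace ℝ (Fin n)} {lam κ : ℝ} (hlam : 0 < lam)
    {f : EuclideanSpace ℝ (Fin n) → ℝ} (hf : ∀ x, 0 ≤ f x) (x : EuclideanSpace ℝ (Fin n)) :
    0 ≤ kelvin c lam κ f x := by
  unfold kelvin; have := hf (inversion c lam x); positivity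

lemma reflKernel_nonneg {c : EuclideanSpace ℝ (Fin n)} {lam κ : ℝ} (hlam : 0 < lam)
    (x y : EuclideanSpace ℝ (Fin n)) : 0 ≤ reflKernel c lam κ x y := by
  unfold reflKernel; positivity

lemma measurable_inversion (c : EuclideanSpace ℝ (Fin n)) (lam : ℝ) :
    Measurable (inversion c lam) := by
  unfold inversion
  simp only [vsub_eq_sub, vadd_eq_add]
  fun_prop

lemma measurable_kelvin (c : EuclideanSpace ℝ (Fin n)) (lam κ : ℝ)
    {f : EuclideanSpace ℝ (Fin n) → ℝ} (hf : Measurable f) : Measurable (kelvin c lam κ f) := by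
  exact ((measurable_const.div (measurable_id.dist measurable_const)).pow_const κ).mul
    (hf.comp (measurable_inversion c lam))

lemma measurable_reflKernel (c : EuclideanSpace ℝ (Fin n)) (lam κ : ℝ)
    (x : EuclideanSpace ℝ (Fin n)) : Measurable (reflKernel c lam κ x) := by
  unfold reflKernel
  have := measurable_inversion c lam
  fun_prop

section Identities

variable {c x y : EuclideanSpace ℝ (Fin n)} {lam : ℝ} (κ : ℝ)

lemma kernel_inversion_left (hlam : 0 < lam) (hx : x ≠ c) (hy : y ≠ c) :
    (lam / dist x c) ^ κ * ‖inversion c lam x - y‖ ^ (-κ) = reflKernel c lam κ x y := by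
  have hx' : 0 < dist x c := dist_pos.2 hx
  rw [reflKernel, mul_comm (dist y c), ← dist_inversion_mul_dist_center_eq hx hy, ← dist_eq_norm,
    mul_div_assoc, Real.mul_rpow dist_nonneg (by positivity), mul_comm,
    Real.rpow_neg (by positivity : 0 ≤ dist x c / lam), ← Real.inv_rpow (by positivity), inv_div]

lemma kernel_inversion_right (hlam : 0 < lam) (hy : y ≠ c) :
    (lam / dist y c) ^ (2 * n) * ‖x - inversion c lam y‖ ^ (-κ) =
      reflKernel c lam κ x y * (lam / dist y c) ^ (2 * n - κ) := by
  have hy' : 0 < dist y c := dist_pos.2 hy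
  have h1 : dist y c * dist x (inversion c lam y) / lam =
      (lam / dist y c)⁻¹ * dist x (inversion c lam y) := by field_simp
  rw [reflKernel, h1, Real.mul_rpow (by positivity) dist_nonneg, Real.inv_rpow (by positivity),
    Real.rpow_neg (by positivity : 0 ≤ lam / dist y c), inv_inv, mul_right_comm,
    ← Real.rpow_add (by positivity), ← dist_eq_norm, ← Real.rpow_natCast]
  push_cast; ring_nf

lemma kernel_inversion_inversion (hlam : 0 < lam) (hx : x ≠ c) (hy : y ≠ c) :
    (lam / dist x c) ^ κ * ((lam / dist y c) ^ (2 * n) *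
      ‖inversion c lam x - inversion c lam y‖ ^ (-κ)) =
      ‖x - y‖ ^ (-κ) * (lam / dist y c) ^ (2 * n - κ) := by
  have hx' : 0 < dist x c := dist_pos.2 hx
  have hy' : 0 < dist y c := dist_pos.2 hy
  have h1 : lam ^ 2 / (dist x c * dist y c) = (lam / dist x c) * (lam / dist y c) := by field_simp
  have h2 : (2 * n - κ : ℝ) = ((2 * n : ℕ) : ℝ) + -κ := by push_cast; ring
  rw [← dist_eq_norm, dist_inversion_inversion hx hy, h1, ← dist_eq_norm,
    Real.mul_rpow (by positivity) dist_nonneg, Real.mul_rpow (by positivity) (by positivity),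
    h2, Real.rpow_add (by positivity), Real.rpow_natCast,
    Real.rpow_neg (by positivity : 0 ≤ lam / dist x c)]
  have : (lam / dist x c) ^ κ ≠ 0 := (by positivity : 0 < (lam / dist x c) ^ κ).ne'
  field_simp

/-- The reflected distance exceeds the distance for two points of the ball: the difference of the
squares is `(lam² - |x - c|²) (lam² - |y - c|²) / lam²`. -/
lemma dist_lt_reflected (hlam : 0 < lam) (hx : x ∈ ball c lam) (hy : y ∈ ball c lam)
    (hyc : y ≠ c) : dist x y < dist y c * dist x (inversion c lam y) / lam := by
  have hy' : 0 < dist y c := dist_pos.2 hyc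
  refine lt_of_pow_lt_pow_left₀ 2 (by positivity) ?_
  obtain ⟨a, rfl⟩ : ∃ a, x = a + c := ⟨x - c, by simp⟩
  obtain ⟨b, rfl⟩ : ∃ b, y = b + c := ⟨y - c, by simp⟩
  simp only [mem_ball, dist_eq_norm, inversion, vsub_eq_sub, vadd_eq_add, add_sub_add_right_eq_sub,
    add_sub_cancel_right] at *
  have e : (‖b‖ * ‖a - (lam / ‖b‖) ^ 2 • b‖ / lam) ^ 2 =
      ‖a - b‖ ^ 2 + (lam ^ 2 - ‖a‖ ^ 2) * (lam ^ 2 - ‖b‖ ^ 2) / lam ^ 2 := by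
    rw [div_pow, mul_pow, norm_sub_sq_real, norm_sub_sq_real, inner_smul_right, norm_smul,
      Real.norm_of_nonneg (by positivity)]
    field_simp
    ring
  rw [e]
  have h1 : 0 < lam ^ 2 - ‖a‖ ^ 2 := by nlinarith [norm_nonneg a]
  have h2 : 0 < lam ^ 2 - ‖b‖ ^ 2 := by nlinarith [norm_nonneg b]
  have : 0 < (lam ^ 2 - ‖a‖ ^ 2) * (lam ^ 2 - ‖b‖ ^ 2) / lam ^ 2 := by positivity
  linarith

lemma reflKernel_lt (hκ : 0 < κ) (hlam : 0 < lam) (hx : x ∈ ball c lam) (hy : y ∈ ball c lam)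
    (hyc : y ≠ c) (hxy : y ≠ x) : reflKernel c lam κ x y < ‖x - y‖ ^ (-κ) := by
  rw [reflKernel, ← dist_eq_norm]
  exact Real.rpow_lt_rpow_of_neg (dist_pos.2 hxy.symm) (dist_lt_reflected hlam hx hy hyc)
    (by linarith)

end Identities

section Representation

variable [Nonempty (Fin n)] {c x : EuclideanSpace ℝ (Fin n)} {lam κ : ℝ}
  {w : EuclideanSpace ℝ (Fin n) → ℝ}

lemma rieszPot_eq_setLIntegral (hlam : 0 < lam) (hw : Measurable w)
    (hw0 : ∀ y, 0 ≤ w y) :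
    rieszPot κ w x = ∫⁻ y in ball c lam \ {c},
      ENNReal.ofReal (‖x - y‖ ^ (-κ) * w y + reflKernel c lam κ x y *
        kelvin c lam (2 * n - κ) w y) := by
  rw [rieszPot, lintegral_split_inversion (c := c) hlam, ← lintegral_add_left (by fun_prop)]
  refine setLIntegral_congr_fun (measurableSet_ball.diff (measurableSet_singleton c))
    fun y hy => ?_
  have h0 := hw0 (inversion c lam y)
  have h0' := hw0 y
  have := reflKernel_nonneg (c := c) (κ := κ) hlam x y
  have := kelvin_nonneg (c := c) (κ := 2 * n - κ) hlam hw0 y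
  beta_reduce
  rw [← ENNReal.ofReal_mul (by positivity), ← ENNReal.ofReal_add (by positivity) (by positivity),
    ← mul_assoc, kernel_inversion_right κ hlam hy.2, kelvin, mul_assoc]

lemma rieszPot_inversion_eq_setLIntegral (hlam : 0 < lam) (hx : x ≠ c) (hw : Measurable w)
    (hw0 : ∀ y, 0 ≤ w y) :
    ENNReal.ofReal ((lam / dist x c) ^ κ) * rieszPot κ w (inversion c lam x) =
      ∫⁻ y in ball c lam \ {c}, ENNReal.ofReal (‖x - y‖ ^ (-κ) * kelvin c lam (2 * n - κ) w y +
        reflKernel c lam κ x y * w y) := by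
  rw [rieszPot, ← lintegral_const_mul _ (by fun_prop), lintegral_split_inversion (c := c) hlam,
    ← lintegral_add_left (by fun_prop)]
  refine setLIntegral_congr_fun (measurableSet_ball.diff (measurableSet_singleton c))
    fun y hy => ?_
  have h0 := hw0 (inversion c lam y)
  have h0' := hw0 y
  have := reflKernel_nonneg (c := c) (κ := κ) hlam x y
  have := kelvin_nonneg (c := c) (κ := 2 * n - κ) hlam hw0 y
  beta_reduce
  rw [← ENNReal.ofReal_mul (by positivity), ← ENNReal.ofReal_mul (by positivity),
    ← ENNReal.ofReal_mul (by positivity), ← ENNReal.ofReal_add (by positivity) (by positivity),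
    ← mul_assoc, kernel_inversion_left κ hlam hx hy.2, kelvin, ← mul_assoc (‖x - y‖ ^ (-κ)),
    ← kernel_inversion_inversion κ hlam hx hy.2]
  congr 1; ring

lemma ae_restrict_punctured_ball {P : EuclideanSpace ℝ (Fin n) → Prop}
    (h : ∀ y ∈ ball c lam \ {c}, y ≠ x → P y) :
    ∀ᵐ y ∂(volume.restrict (ball c lam \ {c})), P y := by
  rw [ae_restrict_iff' (measurableSet_ball.diff (measurableSet_singleton c))]
  filter_upwards [Measure.ae_ne volume x] with y hy hyB using h y hyB hy

lemma rieszPot_le_add (hκ : 0 < κ) (hlam : 0 < lam) (hx : x ∈ ball c lam \ {c})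
    (hw : Measurable w) (hw0 : ∀ y, 0 ≤ w y) :
    rieszPot κ w x ≤ ENNReal.ofReal ((lam / dist x c) ^ κ) * rieszPot κ w (inversion c lam x) +
      ∫⁻ y in ball c lam \ {c},
        ENNReal.ofReal (‖x - y‖ ^ (-κ) * (w y - kelvin c lam (2 * n - κ) w y)) := by
  rw [rieszPot_eq_setLIntegral (c := c) hlam hw hw0,
    rieszPot_inversion_eq_setLIntegral hlam hx.2 hw hw0]
  have hmk := measurable_kelvin c lam (2 * n - κ) hw
  have hmr := measurable_reflKernel c lam κ x
  rw [← lintegral_add_left (by fun_prop)]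
  refine lintegral_mono_ae (ae_restrict_punctured_ball (x := x) fun y hy hyx => ?_)
  have hlt := reflKernel_lt κ hκ hlam hx.1 hy.1 hy.2 hyx
  have h0 := reflKernel_nonneg (c := c) (κ := κ) hlam x y
  rcases le_total (w y) (kelvin c lam (2 * n - κ) w y) with h | h
  · refine le_add_right (ENNReal.ofReal_le_ofReal ?_)
    nlinarith
  · refine le_trans (ENNReal.ofReal_le_ofReal ?_) ENNReal.ofReal_add_le
    nlinarith

lemma rieszPot_le_of_le_kelvin (hκ : 0 < κ) (hlam : 0 < lam) (hx : x ∈ ball c lam \ {c})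
    (hw : Measurable w) (hw0 : ∀ y, 0 ≤ w y)
    (h : ∀ y ∈ ball c lam \ {c}, w y ≤ kelvin c lam (2 * n - κ) w y) :
    rieszPot κ w x ≤
      ENNReal.ofReal ((lam / dist x c) ^ κ) * rieszPot κ w (inversion c lam x) := by
  refine (rieszPot_le_add hκ hlam hx hw hw0).trans (le_of_eq ?_)
  rw [setLIntegral_congr_fun (g := 0) (measurableSet_ball.diff (measurableSet_singleton c))
    fun y hy => ?_]
  · simp
  · exact ENNReal.ofReal_of_nonpos (mul_nonpos_of_nonneg_of_nonpos (by positivity)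
      (by linarith [h y hy]))

/-- Equality case of the comparison of a potential with its Kelvin transform. -/
lemma eq_kelvin_of_rieszPot_eq (hκ : 0 < κ) (hlam : 0 < lam) (hx : x ∈ ball c lam \ {c})
    (hw : Measurable w) (hw0 : ∀ y, 0 ≤ w y)
    (h : ∀ y ∈ ball c lam \ {c}, w y ≤ kelvin c lam (2 * n - κ) w y)
    (hfin : rieszPot κ w x ≠ ∞)
    (heq : ENNReal.ofReal ((lam / dist x c) ^ κ) * rieszPot κ w (inversion c lam x) ≤
      rieszPot κ w x) :
    ∀ᵐ y ∂(volume.restrict (ball c lam \ {c})), w y = kelvin c lam (2 * n - κ) w y := by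
  rw [rieszPot_eq_setLIntegral (c := c) hlam hw hw0] at hfin
  rw [rieszPot_inversion_eq_setLIntegral hlam hx.2 hw hw0,
    rieszPot_eq_setLIntegral (c := c) hlam hw hw0] at heq
  have hmk := measurable_kelvin c lam (2 * n - κ) hw
  have hmr := measurable_reflKernel c lam κ x
  have hae := ae_eq_of_ae_le_of_lintegral_le
    (ae_restrict_punctured_ball (c := c) (lam := lam) (x := x) fun y hy hyx => ?_) hfin
    (by fun_prop) heq
  · filter_upwards [hae, ae_restrict_punctured_ball (c := c) (lam := lam) (x := x)
      (P := fun y => y ≠ x ∧ y ∈ ball c lam \ {c}) (fun y hy hyx => ⟨hyx, hy⟩)] with y hy ⟨hyx, hyB⟩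
    have hlt := reflKernel_lt κ hκ hlam hx.1 hyB.1 hyB.2 hyx
    have h0 := reflKernel_nonneg (c := c) (κ := κ) hlam x y
    have h1 := kelvin_nonneg (c := c) (κ := 2 * n - κ) hlam hw0 y
    have h2 := hw0 y
    rw [ENNReal.ofReal_eq_ofReal_iff (by positivity) (by positivity)] at hy
    have : (‖x - y‖ ^ (-κ) - reflKernel c lam κ x y) *
        (w y - kelvin c lam (2 * n - κ) w y) = 0 := by linarith
    rcases mul_eq_zero.1 this with h | h <;> linarith
  · have hlt := reflKernel_lt κ hκ hlam hx.1 hy.1 hy.2 hyx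
    refine ENNReal.ofReal_le_ofReal ?_
    nlinarith [h y hy]

end Representation

end KelvinTransform

/-! ### Reduction of the integral equation to a positive system -/

section System

open Set Metric EuclideanGeometry

variable {n : ℕ}

/-- The integral equation, split into a coupled system for `u` and `v = |·|^{-σ} * u^p`, for a
positive continuous `u`. Here `ν = n - 2s`, and `R` is the normalising constant; the exponents are
at most critical for the Kelvin transforms of weight `ν` of `u` and of weight `σ` of `v`. -/
structure HartreeSystem (ν σ p q R : ℝ) (u v : EuclideanSpace ℝ (Fin n) → ℝ) : Prop where
  ν_pos : 0 < ν
  ν_lt : ν < n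
  σ_pos : 0 < σ
  σ_lt : σ < n
  p_pos : 0 < p
  q_pos : 0 < q
  R_pos : 0 < R
  p_le : ν * p ≤ 2 * n - σ
  q_le : ν * q ≤ 2 * n - ν - σ
  cont : Continuous u
  pos : ∀ x, 0 < u x
  v_meas : Measurable v
  v_pos : ∀ x, 0 < v x
  v_bdd : ∀ c r, ∃ M : ℝ, ∀ x ∈ ball c r, v x ≤ M
  eq_v : ∀ x, ENNReal.ofReal (v x) = rieszPot σ (fun y => u y ^ p) x
  eq_u : ∀ x, ENNReal.ofReal (u x) = rieszPot ν (fun y => R * (v y * u y ^ q)) x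

lemma rieszPot_pos [Nonempty (Fin n)] {κ : ℝ} {w : EuclideanSpace ℝ (Fin n) → ℝ}
    (hw : Measurable w) (hw0 : ∀ y, 0 < w y) (x : EuclideanSpace ℝ (Fin n)) :
    0 < rieszPot κ w x := by
  rw [pos_iff_ne_zero, rieszPot, Ne, lintegral_eq_zero_iff (by fun_prop)]
  intro h
  have h2 : ∀ᵐ y ∂(volume : Measure (EuclideanSpace ℝ (Fin n))), False := by
    filter_upwards [h, Measure.ae_ne volume x] with y hy hyx
    have h3 : 0 < ‖x - y‖ := norm_pos_iff.2 (sub_ne_zero.2 hyx.symm)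
    have h4 := hw0 y
    simp only [Pi.zero_apply, ENNReal.ofReal_eq_zero] at hy
    exact absurd hy (not_le.2 (by positivity))
  exact h2.exists.elim fun _ h => h

/-- A Riesz potential of a continuous density that is finite at one point is locally bounded. -/
lemma rieszPot_locally_bounded [Nonempty (Fin n)] {κ : ℝ} (hκ : 0 < κ) (hκn : κ < n)
    {w : EuclideanSpace ℝ (Fin n) → ℝ} (hw : Continuous w) (hw0 : ∀ y, 0 ≤ w y)
    {y₀ : EuclideanSpace ℝ (Fin n)} (hfin : rieszPot κ w y₀ ≠ ∞)
    (c : EuclideanSpace ℝ (Fin n)) (r : ℝ) :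
    ∃ M : ℝ, ∀ x ∈ ball c r, rieszPot κ w x ≤ ENNReal.ofReal M := by
  set ρ := 2 * r + dist y₀ c
  obtain ⟨W, hW⟩ := (isCompact_closedBall c ρ).exists_bound_of_continuousOn hw.continuousOn
  have hJ := lintegral_ball_norm_rpow_lt_top hκn (n := n) (ρ + r)
  set J := ∫⁻ z in ball (0 : EuclideanSpace ℝ (Fin n)) (ρ + r), ENNReal.ofReal (‖z‖ ^ (-κ))
  set T := ENNReal.ofReal W * J + ENNReal.ofReal (2 ^ κ) * rieszPot κ w y₀
  have hT : T ≠ ∞ := ENNReal.add_ne_top.2 ⟨ENNReal.mul_ne_top (by simp) hJ.ne,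
    ENNReal.mul_ne_top (by simp) hfin⟩
  refine ⟨T.toReal, fun x hx => ?_⟩
  rw [ENNReal.ofReal_toReal hT, rieszPot,
    ← lintegral_add_compl _ (measurableSet_ball (x := c) (ε := ρ))]
  refine add_le_add ?_ ?_
  · calc ∫⁻ z in ball c ρ, ENNReal.ofReal (‖x - z‖ ^ (-κ) * w z)
        ≤ ∫⁻ z in ball c ρ, ENNReal.ofReal W * ENNReal.ofReal (‖x - z‖ ^ (-κ)) := by
          refine setLIntegral_mono' measurableSet_ball fun z hz => ?_
          rw [mul_comm, ENNReal.ofReal_mul (hw0 z)]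
          gcongr
          exact (le_abs_self _).trans (hW z (ball_subset_closedBall hz))
      _ ≤ ENNReal.ofReal W * J := by
          rw [lintegral_const_mul _ (by fun_prop)]
          gcongr
          exact lintegral_ball_norm_sub_rpow_le c x ρ _ (by rw [mem_ball] at hx; linarith)
  · calc ∫⁻ z in (ball c ρ)ᶜ, ENNReal.ofReal (‖x - z‖ ^ (-κ) * w z)
        ≤ ∫⁻ z in (ball c ρ)ᶜ, ENNReal.ofReal (2 ^ κ) * ENNReal.ofReal (‖y₀ - z‖ ^ (-κ) * w z) := by
          refine lintegral_mono_ae ?_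
          rw [ae_restrict_iff' measurableSet_ball.compl]
          filter_upwards [Measure.ae_ne volume y₀] with z hzy hz
          rw [← ENNReal.ofReal_mul (by positivity), ← mul_assoc]
          refine ENNReal.ofReal_le_ofReal (mul_le_mul_of_nonneg_right ?_ (hw0 z))
          have hz' : ρ ≤ dist z c := by simpa using hz
          have h1 : dist z c ≤ dist z x + dist x c := dist_triangle _ _ _
          have h2 : dist y₀ z ≤ dist y₀ x + dist x z := dist_triangle _ _ _
          have h3 : dist y₀ x ≤ dist y₀ c + dist x c := dist_triangle_right _ _ _
          rw [mem_ball] at hx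
          rw [dist_comm z x] at h1
          have h4 : 0 < dist y₀ z := dist_pos.2 hzy.symm
          have h5 : dist y₀ z / 2 ≤ dist x z := by
            have : ρ = 2 * r + dist y₀ c := rfl
            linarith
          calc ‖x - z‖ ^ (-κ) ≤ (dist y₀ z / 2) ^ (-κ) := by
                rw [← dist_eq_norm]
                exact Real.rpow_le_rpow_of_nonpos (by positivity) h5 (by linarith)
            _ = 2 ^ κ * ‖y₀ - z‖ ^ (-κ) := by
                rw [← dist_eq_norm, Real.div_rpow (by positivity) (by positivity),
                  Real.rpow_neg (by norm_num : (0 : ℝ) ≤ 2), div_inv_eq_mul, mul_comm]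
      _ ≤ ENNReal.ofReal (2 ^ κ) * rieszPot κ w y₀ := by
          rw [lintegral_const_mul' _ _ (by simp)]
          gcongr
          exact setLIntegral_le_lintegral _ _

lemma hartreePotential_eq_rieszPot (σ p : ℝ) (u : EuclideanSpace ℝ (Fin n) → ℝ)
    (y : EuclideanSpace ℝ (Fin n)) :
    hartreePotential σ p u y = rieszPot σ (fun z => u z ^ p) y := by
  simp only [hartreePotential, rieszPot, Real.rpow_neg (norm_nonneg _), one_div]

lemma measurable_rieszPot (κ : ℝ) {w : EuclideanSpace ℝ (Fin n) → ℝ} (hw : Measurable w) :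
    Measurable (rieszPot κ w) := by
  unfold rieszPot
  apply Measurable.lintegral_prod_right'
    (f := fun z : EuclideanSpace ℝ (Fin n) × EuclideanSpace ℝ (Fin n) =>
      ENNReal.ofReal (‖z.1 - z.2‖ ^ (-κ) * w z.2))
  fun_prop

/-- A solution that is positive somewhere is positive everywhere, since the kernel is. -/
lemma IsNonnegSolution.pos [Nonempty (Fin n)] {s σ p q : ℝ} (hR : 0 < rieszConst (2 * s) n)
    {u : EuclideanSpace ℝ (Fin n) → ℝ} (hu : Continuous u)
    (h : IsNonnegSolution s σ p q u) {x₁ : EuclideanSpace ℝ (Fin n)} (hx₁ : u x₁ ≠ 0)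
    (x : EuclideanSpace ℝ (Fin n)) : 0 < u x := by
  refine lt_of_le_of_ne (h.nonneg x) fun hx => hx₁ ?_
  have hm : Measurable (hartreePotential σ p u) := by
    rw [show hartreePotential σ p u = rieszPot σ (fun z => u z ^ p) from
      funext (hartreePotential_eq_rieszPot σ p u)]
    exact measurable_rieszPot σ (hu.measurable.pow_const p)
  have hum := hu.measurable
  have h0 := h.eq_integral x
  rw [← hx, ENNReal.ofReal_zero, eq_comm, lintegral_eq_zero_iff (by fun_prop)] at h0
  have h1 : ENNReal.ofReal (u x₁) = 0 := by
    rw [h.eq_integral x₁, lintegral_eq_zero_iff (by fun_prop)]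
    filter_upwards [h0, Measure.ae_ne volume x] with y hy hyx
    have h3 : 0 < ‖x - y‖ := norm_pos_iff.2 (sub_ne_zero.2 hyx.symm)
    have h4 : 0 < rieszConst (2 * s) n / ‖x - y‖ ^ ((n : ℝ) - 2 * s) := by positivity
    simp only [Pi.zero_apply, mul_eq_zero] at hy ⊢
    rcases hy with (hy | hy) | hy
    · exact absurd (ENNReal.ofReal_eq_zero.1 hy) (not_le.2 h4)
    · exact Or.inl (Or.inr hy)
    · exact Or.inr hy
  exact le_antisymm (ENNReal.ofReal_eq_zero.1 h1) (h.nonneg x₁)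

lemma IsNonnegSolution.hartreeSystem [Nonempty (Fin n)] {s σ p q : ℝ}
    (hR : 0 < rieszConst (2 * s) n) (hs₀ : 0 < s) (hsn : s < (n : ℝ) / 2)
    (hσ₀ : 0 < σ) (hσn : σ < n)
    (hp₀ : 0 < p) (hp : p ≤ (2 * (n : ℝ) - σ) / ((n : ℝ) - 2 * s))
    (hq₀ : 0 < q) (hq : q ≤ ((n : ℝ) + 2 * s - σ) / ((n : ℝ) - 2 * s))
    {u : EuclideanSpace ℝ (Fin n) → ℝ} (hu : Continuous u)
    (h : IsNonnegSolution s σ p q u) {x₁ : EuclideanSpace ℝ (Fin n)} (hx₁ : u x₁ ≠ 0) :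
    HartreeSystem ((n : ℝ) - 2 * s) σ p q (rieszConst (2 * s) n) u
      (fun y => (hartreePotential σ p u y).toReal) := by
  have hpos := h.pos hR hu hx₁
  have hν : 0 < (n : ℝ) - 2 * s := by linarith
  have hcp : Continuous fun y => u y ^ p := hu.rpow_const fun x => Or.inr hp₀.le
  have hfun : hartreePotential σ p u = rieszPot σ (fun z => u z ^ p) :=
    funext (hartreePotential_eq_rieszPot σ p u)
  have hm : Measurable (hartreePotential σ p u) := by
    rw [hfun]; exact measurable_rieszPot σ hcp.measurable
  have hum := hu.measurable
  have h0 := h.eq_integral x₁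
  -- The outer integral is finite and `u` is positive, so the inner integral is finite somewhere.
  have hex : ∃ y₀, hartreePotential σ p u y₀ ≠ ∞ := by
    have hfin := ae_lt_top (by fun_prop) (h0 ▸ ENNReal.ofReal_ne_top)
    obtain ⟨y, hy, hyx⟩ := (hfin.and (Measure.ae_ne volume x₁)).exists
    refine ⟨y, fun htop => ?_⟩
    have h3 : 0 < ‖x₁ - y‖ := norm_pos_iff.2 (sub_ne_zero.2 hyx.symm)
    have h4 : 0 < rieszConst (2 * s) n / ‖x₁ - y‖ ^ ((n : ℝ) - 2 * s) := by positivity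
    have h5 : 0 < u y ^ q := Real.rpow_pos_of_pos (hpos y) q
    rw [htop, ENNReal.mul_top (ENNReal.ofReal_pos.2 h4).ne',
      ENNReal.top_mul (ENNReal.ofReal_pos.2 h5).ne'] at hy
    exact lt_irrefl _ hy
  obtain ⟨y₀, hy₀⟩ := hex
  rw [hfun] at hy₀
  have hbd := rieszPot_locally_bounded hσ₀ hσn hcp
    (fun y => (Real.rpow_pos_of_pos (hpos y) p).le) hy₀
  have hfin : ∀ y, hartreePotential σ p u y ≠ ∞ := by
    intro y
    obtain ⟨M, hM⟩ := hbd y 1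
    rw [hfun]
    exact ((hM y (mem_ball_self one_pos)).trans_lt ENNReal.ofReal_lt_top).ne
  refine ⟨hν, by linarith, hσ₀, hσn, hp₀, hq₀, hR, ?_, ?_, hu, hpos, hm.ennreal_toReal,
    ?_, ?_, ?_, ?_⟩
  · rw [le_div_iff₀ hν] at hp; linarith
  · rw [le_div_iff₀ hν] at hq; linarith
  · intro x
    refine ENNReal.toReal_pos (ne_of_gt ?_) (hfin x)
    rw [hfun]
    exact rieszPot_pos hcp.measurable (fun y => Real.rpow_pos_of_pos (hpos y) p) x
  · intro c r
    obtain ⟨M, hM⟩ := hbd c r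
    refine ⟨max M 0, fun x hx => ENNReal.toReal_le_of_le_ofReal (le_max_right _ _) ?_⟩
    rw [hfun]
    exact (hM x hx).trans (ENNReal.ofReal_le_ofReal (le_max_left _ _))
  · intro x
    rw [ENNReal.ofReal_toReal (hfin x), hfun]
  · intro x
    rw [h.eq_integral x, rieszPot]
    refine lintegral_congr fun y => ?_
    have h5 : 0 < u y ^ q := Real.rpow_pos_of_pos (hpos y) q
    rw [← ENNReal.ofReal_toReal (hfin y), ← ENNReal.ofReal_mul (by positivity),
      ← ENNReal.ofReal_mul (by positivity), ENNReal.ofReal_toReal (hfin y),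
      Real.rpow_neg (norm_nonneg _)]
    congr 1
    rw [div_eq_mul_inv]; ring

end System

/-! ### Comparison of a solution with its Kelvin transform -/

section Comparison

open Set Metric EuclideanGeometry

lemma exists_rpow_sub_rpow_le {p m : ℝ} (hp : 0 < p) (hm : 0 < m) (M : ℝ) :
    ∃ K : ℝ, 0 ≤ K ∧ ∀ a b : ℝ, m ≤ b → b ≤ a → a ≤ M → a ^ p - b ^ p ≤ K * (a - b) := by
  refine ⟨p * (m ^ (p - 1) + |M| ^ (p - 1)), by positivity, fun a b hb hab ha => ?_⟩
  rcases hab.eq_or_lt with rfl | hlt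
  · simp
  have hb0 : 0 < b := hm.trans_le hb
  obtain ⟨ξ, hξ, h⟩ := exists_hasDerivAt_eq_slope (fun t => t ^ p) (fun t => p * t ^ (p - 1)) hlt
    (fun t ht => (Real.continuousAt_rpow_const t p
      (Or.inl (hb0.trans_le ht.1).ne')).continuousWithinAt)
    (fun t ht => Real.hasDerivAt_rpow_const (Or.inl (hb0.trans ht.1).ne'))
  have hξ0 : 0 < ξ := hb0.trans hξ.1
  rw [eq_div_iff (by linarith)] at h
  rw [← h]
  refine mul_le_mul_of_nonneg_right (mul_le_mul_of_nonneg_left ?_ hp.le) (by linarith)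
  have h1 : 0 ≤ m ^ (p - 1) := by positivity
  have h2 : 0 ≤ |M| ^ (p - 1) := by positivity
  rcases le_total 1 p with h3 | h3
  · have := Real.rpow_le_rpow (z := p - 1) hξ0.le
      ((hξ.2.le.trans ha).trans (le_abs_self M)) (by linarith)
    linarith
  · have := Real.rpow_le_rpow_of_nonpos (z := p - 1) hm (hb.trans hξ.1.le) (by linarith)
    linarith

variable {n : ℕ}

/-- Bound for an integral against a nonnegative kernel of a function that is at most `D₁`, and at
most `D₁ + D₂` on a set `N`. -/
lemma setLIntegral_mul_le {K g : EuclideanSpace ℝ (Fin n) → ℝ} (hK : Measurable K)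
    (hK0 : ∀ y, 0 ≤ K y) {S N : Set (EuclideanSpace ℝ (Fin n))} (hS : MeasurableSet S)
    (hN : MeasurableSet N) {D₁ D₂ : ℝ} (hD₁ : 0 ≤ D₁) (hD₂ : 0 ≤ D₂)
    (h₁ : ∀ y ∈ S, y ∉ N → g y ≤ D₁) (h₂ : ∀ y ∈ S, y ∈ N → g y ≤ D₁ + D₂) :
    ∫⁻ y in S, ENNReal.ofReal (K y * g y) ≤
      ENNReal.ofReal D₁ * (∫⁻ y in S, ENNReal.ofReal (K y)) +
        ENNReal.ofReal D₂ * ∫⁻ y in N, ENNReal.ofReal (K y) := by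
  calc ∫⁻ y in S, ENNReal.ofReal (K y * g y)
      ≤ ∫⁻ y in S, (ENNReal.ofReal D₁ * ENNReal.ofReal (K y) +
          N.indicator (fun y => ENNReal.ofReal D₂ * ENNReal.ofReal (K y)) y) := by
        refine setLIntegral_mono' hS fun y hy => ?_
        by_cases hyN : y ∈ N
        · rw [indicator_of_mem hyN, ← add_mul, ← ENNReal.ofReal_add hD₁ hD₂,
            ← ENNReal.ofReal_mul (by positivity), mul_comm]
          exact ENNReal.ofReal_le_ofReal (mul_le_mul_of_nonneg_right (h₂ y hy hyN) (hK0 y))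
        · rw [indicator_of_notMem hyN, add_zero, ← ENNReal.ofReal_mul (by positivity), mul_comm]
          exact ENNReal.ofReal_le_ofReal (mul_le_mul_of_nonneg_right (h₁ y hy hyN) (hK0 y))
    _ ≤ _ := by
        rw [lintegral_add_left (by fun_prop), lintegral_const_mul _ (by fun_prop),
          ← lintegral_const_mul (μ := volume.restrict N) _ (by fun_prop), ← lintegral_indicator hN]
        gcongr
        exact Measure.restrict_le_self

lemma kelvin_rpow {c x : EuclideanSpace ℝ (Fin n)} {lam ν p β : ℝ} (hlam : 0 < lam) (hx : x ≠ c)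
    {u : EuclideanSpace ℝ (Fin n) → ℝ} (hu : ∀ x, 0 < u x) :
    kelvin c lam β (fun y => u y ^ p) x =
      (lam / dist x c) ^ (β - ν * p) * kelvin c lam ν u x ^ p := by
  have hd : 0 < dist x c := dist_pos.2 hx
  rw [kelvin, kelvin, Real.mul_rpow (by positivity) (hu _).le, ← Real.rpow_mul (by positivity),
    ← mul_assoc, ← Real.rpow_add (by positivity)]
  congr 2; ring

lemma kelvin_const_mul {c x : EuclideanSpace ℝ (Fin n)} {lam ν σ q R β : ℝ} (hlam : 0 < lam)
    (hx : x ≠ c) {u v : EuclideanSpace ℝ (Fin n) → ℝ} (hu : ∀ x, 0 < u x) :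
    kelvin c lam β (fun y => R * (v y * u y ^ q)) x = (lam / dist x c) ^ (β - σ - ν * q) *
      (R * (kelvin c lam σ v x * kelvin c lam ν u x ^ q)) := by
  have hd : 0 < dist x c := dist_pos.2 hx
  have h1 := kelvin_rpow (ν := ν) (p := q) (β := β - σ) hlam hx hu
  have h2 : (lam / dist x c) ^ β = (lam / dist x c) ^ (β - σ) * (lam / dist x c) ^ σ := by
    rw [← Real.rpow_add (by positivity), sub_add_cancel]
  simp only [kelvin] at h1 ⊢
  rw [h2]
  linear_combination R * (lam / dist x c) ^ σ * v (inversion c lam x) * h1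

lemma continuousAt_kelvin {c x : EuclideanSpace ℝ (Fin n)} {lam : ℝ} (ν : ℝ) (hlam : 0 < lam)
    (hx : x ≠ c) {u : EuclideanSpace ℝ (Fin n) → ℝ} (hu : Continuous u) :
    ContinuousAt (fun z : ℝ × EuclideanSpace ℝ (Fin n) => kelvin c z.1 ν u z.2) (lam, x) := by
  have hd : 0 < dist x c := dist_pos.2 hx
  unfold kelvin
  refine ContinuousAt.mul ?_ ?_
  · refine ContinuousAt.rpow_const ?_ (Or.inl (by positivity))
    exact continuousAt_fst.div (continuousAt_snd.dist continuousAt_const) hd.ne'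
  · exact hu.continuousAt.comp
      (ContinuousAt.inversion continuousAt_const continuousAt_fst continuousAt_snd hx)

namespace HartreeSystem

variable {ν σ p q R : ℝ} {u v : EuclideanSpace ℝ (Fin n) → ℝ}

lemma ofReal_kelvin_v (S : HartreeSystem ν σ p q R u v) {lam : ℝ} (hlam : 0 < lam)
    (c x : EuclideanSpace ℝ (Fin n)) : ENNReal.ofReal (kelvin c lam σ v x) =
      ENNReal.ofReal ((lam / dist x c) ^ σ) *
        rieszPot σ (fun y => u y ^ p) (inversion c lam x) := by
  rw [← S.eq_v, kelvin, ENNReal.ofReal_mul (by positivity)]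

lemma ofReal_kelvin_u (S : HartreeSystem ν σ p q R u v) {lam : ℝ} (hlam : 0 < lam)
    (c x : EuclideanSpace ℝ (Fin n)) : ENNReal.ofReal (kelvin c lam ν u x) =
      ENNReal.ofReal ((lam / dist x c) ^ ν) *
        rieszPot ν (fun y => R * (v y * u y ^ q)) (inversion c lam x) := by
  rw [← S.eq_u, kelvin, ENNReal.ofReal_mul (by positivity)]

lemma kelvin_pos {lam : ℝ} (hlam : 0 < lam) {f : EuclideanSpace ℝ (Fin n) → ℝ} (hf : ∀ x, 0 < f x)
    {c x : EuclideanSpace ℝ (Fin n)} (hx : x ≠ c) (κ : ℝ) : 0 < kelvin c lam κ f x := by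
  have hd : 0 < dist x c := dist_pos.2 hx
  have := hf (inversion c lam x)
  unfold kelvin
  positivity

lemma density_pos (S : HartreeSystem ν σ p q R u v) (y : EuclideanSpace ℝ (Fin n)) :
    0 < R * (v y * u y ^ q) :=
  mul_pos S.R_pos (mul_pos (S.v_pos y) (Real.rpow_pos_of_pos (S.pos y) q))

lemma measurable_density (S : HartreeSystem ν σ p q R u v) :
    Measurable fun y => R * (v y * u y ^ q) :=
  (S.v_meas.mul (S.cont.measurable.pow_const q)).const_mul R

lemma one_lt_div_dist {lam : ℝ} {c y : EuclideanSpace ℝ (Fin n)}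
    (hy : y ∈ ball c lam \ {c}) : 1 < lam / dist y c := by
  rw [one_lt_div (dist_pos.2 hy.2)]
  exact hy.1

/-- Subcriticality of `p`: up to a factor at least one, the density of `v` transforms like `u^p`. -/
lemma rpow_kelvin_le (S : HartreeSystem ν σ p q R u v) {lam : ℝ} (hlam : 0 < lam)
    {c y : EuclideanSpace ℝ (Fin n)} (hy : y ∈ ball c lam \ {c}) :
    kelvin c lam ν u y ^ p ≤ kelvin c lam (2 * n - σ) (fun y => u y ^ p) y := by
  rw [kelvin_rpow (ν := ν) hlam hy.2 S.pos]
  have := kelvin_pos hlam S.pos hy.2 ν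
  refine le_mul_of_one_le_left (by positivity)
    (Real.one_le_rpow (one_lt_div_dist hy).le (by linarith [S.p_le]))

lemma mul_rpow_kelvin_le (S : HartreeSystem ν σ p q R u v) {lam : ℝ} (hlam : 0 < lam)
    {c y : EuclideanSpace ℝ (Fin n)} (hy : y ∈ ball c lam \ {c}) :
    R * (kelvin c lam σ v y * kelvin c lam ν u y ^ q) ≤
      kelvin c lam (2 * n - ν) (fun y => R * (v y * u y ^ q)) y := by
  rw [kelvin_const_mul (ν := ν) (σ := σ) hlam hy.2 S.pos]
  have := kelvin_pos hlam S.pos hy.2 ν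
  have := kelvin_pos hlam S.v_pos hy.2 σ
  have := S.R_pos
  refine le_mul_of_one_le_left (by positivity)
    (Real.one_le_rpow (one_lt_div_dist hy).le (by linarith [S.q_le]))

/-- `u` decays at most like the fundamental solution. -/
lemma exists_lower_bound [Nonempty (Fin n)] (S : HartreeSystem ν σ p q R u v)
    (c : EuclideanSpace ℝ (Fin n)) :
    ∃ c₀ : ℝ, 0 < c₀ ∧ ∀ x, c₀ * (1 + dist x c) ^ (-ν) ≤ u x := by
  have hmeas := S.measurable_density
  have hT : 0 < ∫⁻ y in ball c 1, ENNReal.ofReal (R * (v y * u y ^ q)) := by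
    rw [setLIntegral_pos_iff (by fun_prop)]
    have : Function.support (fun y => ENNReal.ofReal (R * (v y * u y ^ q))) = univ := by
      ext y; simpa using S.density_pos y
    rw [this, univ_inter]
    exact measure_ball_pos _ _ one_pos
  obtain ⟨c₀, hc₀, hc₀T⟩ := ENNReal.lt_iff_exists_nnreal_btwn.1 hT
  refine ⟨c₀, by exact_mod_cast hc₀, fun x => ?_⟩
  rw [← ENNReal.ofReal_le_ofReal_iff (S.pos x).le, S.eq_u, mul_comm,
    ENNReal.ofReal_mul (by positivity), ENNReal.ofReal_coe_nnreal, rieszPot]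
  calc ENNReal.ofReal ((1 + dist x c) ^ (-ν)) * c₀
      ≤ ENNReal.ofReal ((1 + dist x c) ^ (-ν)) *
        ∫⁻ y in ball c 1, ENNReal.ofReal (R * (v y * u y ^ q)) := by gcongr
    _ = ∫⁻ y in ball c 1, ENNReal.ofReal ((1 + dist x c) ^ (-ν)) *
        ENNReal.ofReal (R * (v y * u y ^ q)) := by rw [lintegral_const_mul _ (by fun_prop)]
    _ ≤ ∫⁻ y in ball c 1, ENNReal.ofReal (‖x - y‖ ^ (-ν) * (R * (v y * u y ^ q))) := by
        refine lintegral_mono_ae ?_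
        rw [ae_restrict_iff' measurableSet_ball]
        filter_upwards [Measure.ae_ne volume x] with y hyx hy
        rw [ENNReal.ofReal_mul (show 0 ≤ ‖x - y‖ ^ (-ν) by positivity)]
        gcongr ENNReal.ofReal ?_ * _
        rw [← dist_eq_norm]
        refine Real.rpow_le_rpow_of_nonpos (dist_pos.2 hyx.symm) ?_ (by linarith [S.ν_pos])
        rw [mem_ball] at hy
        linarith [dist_triangle_right x y c]
    _ ≤ _ := setLIntegral_le_lintegral _ _

/-- The Kelvin transform is bounded below in the ball, uniformly for bounded radii; this makes
`t ↦ t^p` Lipschitz on the relevant range even if `p < 1`. -/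
lemma exists_kelvin_lower_bound [Nonempty (Fin n)] (S : HartreeSystem ν σ p q R u v)
    (c : EuclideanSpace ℝ (Fin n)) {L : ℝ} (hL : 0 < L) :
    ∃ m : ℝ, 0 < m ∧ ∀ lam, 0 < lam → lam ≤ L → ∀ x ∈ ball c lam \ {c},
      m ≤ kelvin c lam ν u x := by
  obtain ⟨c₀, hc₀, h⟩ := S.exists_lower_bound c
  refine ⟨c₀ * (1 + L) ^ (-ν), by positivity, fun lam hlam hlamL x hx => ?_⟩
  have hd : 0 < dist x c := dist_pos.2 hx.2
  have hν := S.ν_pos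
  have h1 := h (inversion c lam x)
  rw [dist_inversion_center] at h1
  calc c₀ * (1 + L) ^ (-ν) ≤ c₀ * (dist x c / lam * (1 + lam ^ 2 / dist x c)) ^ (-ν) := by
        refine mul_le_mul_of_nonneg_left
          (Real.rpow_le_rpow_of_nonpos (by positivity) ?_ (by linarith)) hc₀.le
        have h2 : dist x c / lam * (1 + lam ^ 2 / dist x c) = dist x c / lam + lam := by field_simp
        have h3 : dist x c / lam < 1 := (div_lt_one hlam).2 hx.1
        linarith
    _ = (lam / dist x c) ^ ν * (c₀ * (1 + lam ^ 2 / dist x c) ^ (-ν)) := by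
        rw [Real.mul_rpow (by positivity) (by positivity),
          Real.rpow_neg (by positivity : 0 ≤ dist x c / lam), ← Real.inv_rpow (by positivity),
          inv_div]
        ring
    _ ≤ kelvin c lam ν u x := by
        unfold kelvin
        gcongr

/-- The comparison passes from `u` to `v`. -/
lemma v_le_kelvin (S : HartreeSystem ν σ p q R u v) [Nonempty (Fin n)] {lam : ℝ} (hlam : 0 < lam)
    {c : EuclideanSpace ℝ (Fin n)} (h : ∀ x ∈ ball c lam \ {c}, u x ≤ kelvin c lam ν u x)
    {x : EuclideanSpace ℝ (Fin n)} (hx : x ∈ ball c lam \ {c}) : v x ≤ kelvin c lam σ v x := by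
  rw [← ENNReal.ofReal_le_ofReal_iff (kelvin_pos hlam S.v_pos hx.2 σ).le, S.eq_v,
    S.ofReal_kelvin_v hlam]
  refine rieszPot_le_of_le_kelvin S.σ_pos hlam hx (S.cont.measurable.pow_const p)
    (fun y => (Real.rpow_pos_of_pos (S.pos y) p).le) fun y hy => ?_
  exact (Real.rpow_le_rpow (S.pos y).le (h y hy) S.p_pos.le).trans (S.rpow_kelvin_le hlam hy)

/-- The maximum principle in narrow regions: if `u` is at most its Kelvin transform in the ball
outside a set of small measure, then it is in the whole ball. -/
lemma exists_narrow [Nonempty (Fin n)] (S : HartreeSystem ν σ p q R u v)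
    (c : EuclideanSpace ℝ (Fin n)) {L : ℝ} (hL : 0 < L) :
    ∃ δ : ℝ≥0∞, 0 < δ ∧ ∀ lam, 0 < lam → lam ≤ L → ∀ N, MeasurableSet N → N ⊆ ball c lam →
      volume N < δ → (∀ x ∈ ball c lam \ {c}, x ∉ N → u x ≤ kelvin c lam ν u x) →
      ∀ x ∈ ball c lam \ {c}, u x ≤ kelvin c lam ν u x := by
  obtain ⟨m, hm, hmk⟩ := S.exists_kelvin_lower_bound c hL
  obtain ⟨Mu, hMu⟩ := (isCompact_closedBall c L).exists_bound_of_continuousOn S.cont.continuousOn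
  have hMu0 : 0 ≤ Mu := (norm_nonneg _).trans (hMu c (mem_closedBall_self hL.le))
  have hMu' : ∀ x ∈ ball c L, u x ≤ Mu := fun x hx =>
    (le_abs_self _).trans (hMu x (ball_subset_closedBall hx))
  obtain ⟨Mv, hMv⟩ := S.v_bdd c L
  have hMv0 : 0 ≤ Mv := (S.v_pos c).le.trans (hMv c (mem_ball_self hL))
  obtain ⟨Kp, hKp0, hKp⟩ := exists_rpow_sub_rpow_le S.p_pos hm Mu
  obtain ⟨Kq, hKq0, hKq⟩ := exists_rpow_sub_rpow_le S.q_pos hm Mu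
  have hJ := lintegral_ball_norm_rpow_lt_top S.ν_lt (n := n) (L + L)
  set J := ∫⁻ z in ball (0 : EuclideanSpace ℝ (Fin n)) (L + L), ENNReal.ofReal (‖z‖ ^ (-ν))
  have hJ' : ENNReal.ofReal J.toReal = J := ENNReal.ofReal_toReal hJ.ne
  have hR := S.R_pos
  set Q := R * (Kp * Mu ^ q) * J.toReal + R * (Mv * Kq) with hQdef
  have hQ0 : 0 ≤ Q := by positivity
  set ε := 1 / (2 * (Q + 1)) with hε
  have hε0 : 0 < ε := by positivity
  obtain ⟨δ₁, hδ₁, H₁⟩ := exists_setLIntegral_kernel_le S.σ_lt c L hε0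
  obtain ⟨δ₂, hδ₂, H₂⟩ := exists_setLIntegral_kernel_le S.ν_lt c L hε0
  refine ⟨min δ₁ δ₂, lt_min hδ₁ hδ₂, fun lam hlam hlamL N hN hNB hvol hout => ?_⟩
  have hBL : ball c lam ⊆ ball c L := ball_subset_ball hlamL
  have hBm : MeasurableSet (ball c lam \ {c}) :=
    measurableSet_ball.diff (measurableSet_singleton c)
  have hup : Measurable fun y => u y ^ p := S.cont.measurable.pow_const p
  set k := kelvin c lam ν u with hk
  have hkpos : ∀ y ∈ ball c lam \ {c}, 0 < k y := fun y hy => kelvin_pos hlam S.pos hy.2 ν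
  -- The two integral inequalities halve the supremum of `u - k`, by the choice of `ε`.
  have step : ∀ A : ℝ, 0 ≤ A → (∀ x ∈ ball c lam \ {c}, u x - k x ≤ A) →
      ∀ x ∈ ball c lam \ {c}, u x - k x ≤ A / 2 := by
    intro A hA hdiff
    have hpow : ∀ {r K : ℝ}, 0 < r → 0 ≤ K →
        (∀ a b : ℝ, m ≤ b → b ≤ a → a ≤ Mu → a ^ r - b ^ r ≤ K * (a - b)) →
        ∀ y ∈ ball c lam \ {c}, u y ^ r - k y ^ r ≤ K * A := by
      intro r K hr hK0 hK y hy
      rcases le_total (u y) (k y) with h | h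
      · have := Real.rpow_le_rpow (S.pos y).le h hr.le
        have : 0 ≤ K * A := by positivity
        linarith
      · exact (hK _ _ (hmk lam hlam hlamL y hy) h (hMu' y (hBL hy.1))).trans
          (mul_le_mul_of_nonneg_left (hdiff y hy) hK0)
    have hpow' : ∀ {r : ℝ}, 0 < r → ∀ y ∈ ball c lam \ {c}, y ∉ N → u y ^ r - k y ^ r ≤ 0 := by
      intro r hr y hy hyN
      have := Real.rpow_le_rpow (S.pos y).le (hout y hy hyN) hr.le
      linarith
    have hv : ∀ x ∈ ball c lam \ {c}, v x - kelvin c lam σ v x ≤ Kp * A * ε := by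
      intro x hx
      have hkv := kelvin_pos hlam S.v_pos hx.2 σ
      have h1 := rieszPot_le_add S.σ_pos hlam hx hup
        (fun y => (Real.rpow_pos_of_pos (S.pos y) p).le)
      rw [← S.eq_v, ← S.ofReal_kelvin_v hlam] at h1
      have h2 := setLIntegral_mul_le (K := fun y => ‖x - y‖ ^ (-σ))
        (g := fun y => u y ^ p - kelvin c lam (2 * n - σ) (fun y => u y ^ p) y) (by fun_prop)
        (fun y => by positivity) hBm hN le_rfl (show 0 ≤ Kp * A by positivity)
        (fun y hy hyN => (sub_le_sub_left (S.rpow_kelvin_le hlam hy) _).trans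
          (hpow' S.p_pos y hy hyN))
        (fun y hy hyN => (sub_le_sub_left (S.rpow_kelvin_le hlam hy) _).trans
          ((hpow S.p_pos hKp0 hKp y hy).trans (by linarith)))
      have h3 := H₁ N hN (hNB.trans hBL) (hvol.trans_le (min_le_left _ _)) x (hBL hx.1)
      have h4 : ENNReal.ofReal (v x) ≤
          ENNReal.ofReal (kelvin c lam σ v x) + ENNReal.ofReal (Kp * A) * ENNReal.ofReal ε := by
        refine h1.trans (add_le_add_right (h2.trans ?_) _)
        rw [ENNReal.ofReal_zero, zero_mul, zero_add]
        gcongr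
      rw [← ENNReal.ofReal_mul (by positivity), ← ENNReal.ofReal_add hkv.le (by positivity),
        ENNReal.ofReal_le_ofReal_iff (by positivity)] at h4
      linarith
    intro x hx
    have hku := hkpos x hx
    -- `v u^q - v' k^q ≤ (v - v')⁺ u^q + v (u^q - k^q)⁺`.
    have hprod : ∀ y ∈ ball c lam \ {c}, ∀ D : ℝ, 0 ≤ D → u y ^ q - k y ^ q ≤ D →
        R * (v y * u y ^ q) - kelvin c lam (2 * n - ν) (fun y => R * (v y * u y ^ q)) y ≤
          R * (Kp * A * ε * Mu ^ q) + R * (Mv * D) := by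
      intro y hy D hD hle
      refine (sub_le_sub_left (S.mul_rpow_kelvin_le hlam hy) _).trans ?_
      rw [← mul_sub, ← mul_add]
      refine mul_le_mul_of_nonneg_left ?_ hR.le
      have hvy := hv y hy
      have hkv := kelvin_pos hlam S.v_pos hy.2 σ
      have huq : 0 < u y ^ q := Real.rpow_pos_of_pos (S.pos y) q
      have huq' : u y ^ q ≤ Mu ^ q := Real.rpow_le_rpow (S.pos y).le (hMu' y (hBL hy.1)) S.q_pos.le
      have hkq : 0 < k y ^ q := Real.rpow_pos_of_pos (hkpos y hy) q
      have hvM := hMv y (hBL hy.1)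
      have hvp := S.v_pos y
      have hc0 : 0 ≤ Kp * A * ε := by positivity
      have h1 : v y * D ≤ Mv * D := by gcongr
      have h2 : Kp * A * ε * u y ^ q ≤ Kp * A * ε * Mu ^ q := by gcongr
      rcases le_total (v y) (kelvin c lam σ v y) with h | h
      · have h3 : v y * k y ^ q ≤ kelvin c lam σ v y * k y ^ q := by gcongr
        have h4 : v y * (u y ^ q - k y ^ q) ≤ v y * D := by gcongr
        have h5 : 0 ≤ Kp * A * ε * u y ^ q := by positivity
        linarith
      · have h3 : (v y - kelvin c lam σ v y) * u y ^ q ≤ Kp * A * ε * u y ^ q := by gcongr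
        have h4 : kelvin c lam σ v y * (u y ^ q - k y ^ q) ≤ kelvin c lam σ v y * D := by gcongr
        have h5 : kelvin c lam σ v y * D ≤ v y * D := by gcongr
        linarith
    have h1 := rieszPot_le_add S.ν_pos hlam hx S.measurable_density
      (fun y => (S.density_pos y).le)
    rw [← S.eq_u, ← S.ofReal_kelvin_u hlam] at h1
    have h2 := setLIntegral_mul_le (K := fun y => ‖x - y‖ ^ (-ν))
      (g := fun y => R * (v y * u y ^ q) -
        kelvin c lam (2 * n - ν) (fun y => R * (v y * u y ^ q)) y) (by fun_prop)
      (fun y => by positivity) hBm hN (show 0 ≤ R * (Kp * A * ε * Mu ^ q) by positivity)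
      (show 0 ≤ R * (Mv * (Kq * A)) by positivity)
      (fun y hy hyN => (hprod y hy 0 le_rfl (hpow' S.q_pos y hy hyN)).trans (by simp))
      (fun y hy hyN => hprod y hy (Kq * A) (by positivity) (hpow S.q_pos hKq0 hKq y hy))
    have h3 := H₂ N hN (hNB.trans hBL) (hvol.trans_le (min_le_right _ _)) x (hBL hx.1)
    have h4 : ∫⁻ y in ball c lam \ {c}, ENNReal.ofReal (‖x - y‖ ^ (-ν)) ≤ J := by
      refine (lintegral_mono_set (sdiff_subset.trans hBL)).trans
        (lintegral_ball_norm_sub_rpow_le c x L _ ?_)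
      have : dist x c < L := hBL hx.1
      linarith
    have h5 : ENNReal.ofReal (u x) ≤ ENNReal.ofReal (k x) +
        (ENNReal.ofReal (R * (Kp * A * ε * Mu ^ q)) * ENNReal.ofReal J.toReal +
          ENNReal.ofReal (R * (Mv * (Kq * A))) * ENNReal.ofReal ε) := by
      refine h1.trans (add_le_add_right (h2.trans ?_) _)
      rw [hJ']
      gcongr
    rw [← ENNReal.ofReal_mul (by positivity), ← ENNReal.ofReal_mul (by positivity),
      ← ENNReal.ofReal_add (by positivity) (by positivity),
      ← ENNReal.ofReal_add hku.le (by positivity), ENNReal.ofReal_le_ofReal_iff (by positivity)] at h5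
    have h6 : R * (Kp * A * ε * Mu ^ q) * J.toReal + R * (Mv * (Kq * A)) * ε = A * (Q * ε) := by
      rw [hQdef]; ring
    have h7 : Q * ε ≤ 1 / 2 := by
      rw [hε, mul_one_div, div_le_div_iff₀ (by positivity) (by norm_num)]
      linarith
    have h8 : A * (Q * ε) ≤ A * (1 / 2) := by gcongr
    linarith
  have iter : ∀ j : ℕ, ∀ x ∈ ball c lam \ {c}, u x - k x ≤ Mu * (1 / 2) ^ j := by
    intro j
    induction j with
    | zero =>
      intro x hx
      have := hMu' x (hBL hx.1)
      have := hkpos x hx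
      simp only [pow_zero, mul_one]
      linarith
    | succ j ih =>
      intro x hx
      refine (step _ (by positivity) ih x hx).trans (le_of_eq ?_)
      rw [pow_succ]; ring
  intro x hx
  have hlim : Filter.Tendsto (fun j : ℕ => Mu * (1 / 2 : ℝ) ^ j) Filter.atTop (nhds (Mu * 0)) :=
    (tendsto_pow_atTop_nhds_zero_of_lt_one (by norm_num) (by norm_num)).const_mul Mu
  have := ge_of_tendsto' hlim fun j => iter j x hx
  linarith

/-- If `u` touches its Kelvin transform from below inside the ball, then the exponents are critical
and `u` coincides with its Kelvin transform. -/
lemma eq_kelvin_of_touch [Nonempty (Fin n)] (S : HartreeSystem ν σ p q R u v)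
    {c : EuclideanSpace ℝ (Fin n)} {lam : ℝ} (hlam : 0 < lam)
    (h : ∀ x ∈ ball c lam \ {c}, u x ≤ kelvin c lam ν u x)
    {x₁ : EuclideanSpace ℝ (Fin n)} (hx₁ : x₁ ∈ ball c lam \ {c})
    (heq : u x₁ = kelvin c lam ν u x₁) :
    ν * p = 2 * n - σ ∧ ν * q = 2 * n - ν - σ ∧
      ∀ x ∈ ball c lam \ {c}, u x = kelvin c lam ν u x := by
  have hopen : IsOpen (ball c lam \ {c}) := isOpen_ball.sdiff isClosed_singleton
  have hvk : ∀ x ∈ ball c lam \ {c}, v x ≤ kelvin c lam σ v x := fun x hx => S.v_le_kelvin hlam h hx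
  have hR := S.R_pos
  have hdens := eq_kelvin_of_rieszPot_eq S.ν_pos hlam hx₁ S.measurable_density
    (fun y => (S.density_pos y).le)
    (fun y hy => by
      refine le_trans ?_ (S.mul_rpow_kelvin_le hlam hy)
      have h1 := Real.rpow_le_rpow (S.pos y).le (h y hy) S.q_pos.le
      have h2 := hvk y hy
      have h3 := S.v_pos y
      have h4 := S.pos y
      have h5 := kelvin_pos hlam S.v_pos hy.2 σ
      gcongr)
    (by rw [← S.eq_u]; exact ENNReal.ofReal_ne_top)
    (by rw [← S.ofReal_kelvin_u hlam, ← S.eq_u, heq])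
  have hall : ∀ᵐ y ∂(volume.restrict (ball c lam \ {c})), y ∈ ball c lam \ {c} ∧
      u y = kelvin c lam ν u y ∧ v y = kelvin c lam σ v y ∧ ν * q = 2 * n - ν - σ := by
    filter_upwards [hdens, ae_restrict_mem hopen.measurableSet] with y hy hyB
    rw [kelvin_const_mul (ν := ν) (σ := σ) hlam hyB.2 S.pos] at hy
    have hu1 := h y hyB
    have hv1 := hvk y hyB
    have hu0 := S.pos y
    have hv0 := S.v_pos y
    have hk0 := kelvin_pos hlam S.pos hyB.2 ν
    have hkv0 := kelvin_pos hlam S.v_pos hyB.2 σ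
    have hτ : 0 ≤ 2 * n - ν - σ - ν * q := by linarith [S.q_le]
    have hfac := Real.one_le_rpow (one_lt_div_dist hyB).le hτ
    have huq := Real.rpow_le_rpow hu0.le hu1 S.q_pos.le
    have huq0 : 0 < u y ^ q := by positivity
    have hkq0 : 0 < kelvin c lam ν u y ^ q := by positivity
    have e1 : R * (v y * u y ^ q) ≤ R * (v y * kelvin c lam ν u y ^ q) := by gcongr
    have e2 : R * (v y * kelvin c lam ν u y ^ q) ≤
      R * (kelvin c lam σ v y * kelvin c lam ν u y ^ q) := by gcongr
    have e3 : R * (kelvin c lam σ v y * kelvin c lam ν u y ^ q) ≤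
        (lam / dist y c) ^ (2 * n - ν - σ - ν * q) *
          (R * (kelvin c lam σ v y * kelvin c lam ν u y ^ q)) :=
      le_mul_of_one_le_left (by positivity) hfac
    refine ⟨hyB, ?_, ?_, ?_⟩
    · refine le_antisymm hu1 (not_lt.1 fun hlt => ?_)
      have := Real.rpow_lt_rpow hu0.le hlt S.q_pos
      have : R * (v y * u y ^ q) < R * (v y * kelvin c lam ν u y ^ q) := by gcongr
      linarith
    · refine le_antisymm hv1 (not_lt.1 fun hlt => ?_)
      have : R * (v y * kelvin c lam ν u y ^ q) <
        R * (kelvin c lam σ v y * kelvin c lam ν u y ^ q) := by gcongr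
      linarith
    · by_contra hne
      have hτ' : 0 < 2 * n - ν - σ - ν * q := lt_of_le_of_ne hτ fun h => hne (by linarith)
      have h1 := Real.one_lt_rpow (one_lt_div_dist hyB) hτ'
      have := lt_mul_of_one_lt_left
        (show 0 < R * (kelvin c lam σ v y * kelvin c lam ν u y ^ q) by positivity) h1
      linarith
  have hne : (ae (volume.restrict (ball c lam \ {c}))).NeBot := by
    rw [ae_neBot, Ne, Measure.restrict_eq_zero]
    exact (hopen.measure_pos volume ⟨x₁, hx₁⟩).ne'
  obtain ⟨y₀, hy₀, -, hv₀, hq⟩ := hall.exists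
  have hdens' := eq_kelvin_of_rieszPot_eq S.σ_pos hlam hy₀ (S.cont.measurable.pow_const p)
    (fun y => (Real.rpow_pos_of_pos (S.pos y) p).le)
    (fun y hy => (Real.rpow_le_rpow (S.pos y).le (h y hy) S.p_pos.le).trans
      (S.rpow_kelvin_le hlam hy))
    (by rw [← S.eq_v]; exact ENNReal.ofReal_ne_top)
    (by rw [← S.ofReal_kelvin_v hlam, ← S.eq_v, hv₀])
  obtain ⟨y₁, ⟨hy₁, hu₁, -⟩, hd₁⟩ := (hall.and hdens').exists
  refine ⟨?_, hq, ?_⟩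
  · by_contra hne
    have hτ' : 0 < 2 * n - σ - ν * p :=
      lt_of_le_of_ne (by linarith [S.p_le]) fun h => hne (by linarith)
    rw [kelvin_rpow (ν := ν) hlam hy₁.2 S.pos, ← hu₁] at hd₁
    have h1 := Real.one_lt_rpow (one_lt_div_dist hy₁) hτ'
    have := lt_mul_of_one_lt_left (Real.rpow_pos_of_pos (S.pos y₁) p) h1
    linarith
  · exact Measure.eqOn_open_of_ae_eq (μ := volume) (hall.mono fun y hy => hy.2.1) hopen
      S.cont.continuousOn fun y hy =>
        ((continuousAt_kelvin ν hlam hy.2 S.cont).comp (f := fun y => (lam, y))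
          (by fun_prop)).continuousWithinAt

end HartreeSystem

end Comparison

/-! ### Moving spheres -/

section MovingSpheres

open Set Metric EuclideanGeometry Filter Topology

variable {n : ℕ}

namespace HartreeSystem

variable {ν σ p q R : ℝ} {u v : EuclideanSpace ℝ (Fin n) → ℝ}

/-- The part of the slightly larger ball outside a compact core avoiding the centre is small. -/
lemma exists_small_shell [Nonempty (Fin n)] (c : EuclideanSpace ℝ (Fin n)) (lam : ℝ)
    {δ : ℝ≥0∞} (hδ : 0 < δ) :
    ∃ r, 0 < r ∧ r < 1 ∧ volume (ball c (lam + r) \ (closedBall c (lam - r) \ ball c r)) < δ := by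
  have hlim := tendsto_measure_biInter_gt (μ := volume) (a := (0 : ℝ))
    (s := fun r => ball c (lam + r) \ (closedBall c (lam - r) \ ball c r))
    (fun r _ => (measurableSet_ball.diff
      (measurableSet_closedBall.diff measurableSet_ball)).nullMeasurableSet)
    (fun i j _ hij => sdiff_le_sdiff (ball_subset_ball (by linarith))
      (sdiff_le_sdiff (closedBall_subset_closedBall (by linarith)) (ball_subset_ball hij)))
    ⟨1, one_pos, ((measure_mono sdiff_subset).trans_lt measure_ball_lt_top).ne⟩
  have h0 : volume (⋂ r, ⋂ (_ : r > 0), ball c (lam + r) \ (closedBall c (lam - r) \ ball c r))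
      = 0 := by
    refine measure_mono_null (t := {c} ∪ sphere c lam) (fun x hx => ?_)
      (measure_union_null (measure_singleton c) (Measure.addHaar_sphere volume c lam))
    simp only [mem_iInter, Set.mem_sdiff, mem_ball, mem_closedBall, not_and, not_not] at hx
    by_contra hne
    simp only [mem_union, mem_singleton_iff, Metric.mem_sphere, not_or] at hne
    have hd : 0 < dist x c := dist_pos.2 hne.1
    rcases lt_or_gt_of_ne hne.2 with h | h
    · set r := min (dist x c) (lam - dist x c)
      have hr : 0 < r := lt_min hd (by linarith)
      have h1 := (hx r hr).2 (by linarith [min_le_right (dist x c) (lam - dist x c)])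
      linarith [min_le_left (dist x c) (lam - dist x c)]
    · have := (hx (dist x c - lam) (by linarith)).1
      linarith
  rw [h0] at hlim
  obtain ⟨r, hr3, hr1, hr2⟩ := ((hlim.eventually_lt_const hδ).and
    (Ioo_mem_nhdsGT (show (0 : ℝ) < 1 from one_pos))).exists
  exact ⟨r, hr1, hr2, hr3⟩

/-- Either the moving sphere never stops, or the exponents are critical and it stops at a sphere
in which `u` is symmetric. -/
lemma le_kelvin_or_eq_kelvin [Nonempty (Fin n)] (S : HartreeSystem ν σ p q R u v)
    (c : EuclideanSpace ℝ (Fin n)) :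
    (∀ lam, 0 < lam → ∀ x ∈ ball c lam \ {c}, u x ≤ kelvin c lam ν u x) ∨
    (ν * p = 2 * n - σ ∧ ν * q = 2 * n - ν - σ ∧
      ∃ lam, 0 < lam ∧ ∀ x ∈ ball c lam \ {c}, u x = kelvin c lam ν u x) := by
  rw [or_iff_not_imp_right]
  intro hnosymm
  have hstrict : ∀ lam, 0 < lam → (∀ x ∈ ball c lam \ {c}, u x ≤ kelvin c lam ν u x) →
      ∀ x ∈ ball c lam \ {c}, u x < kelvin c lam ν u x := by
    intro lam hlam h x hx
    refine lt_of_le_of_ne (h x hx) fun heq => hnosymm ?_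
    obtain ⟨h1, h2, h3⟩ := S.eq_kelvin_of_touch hlam h hx heq
    exact ⟨h1, h2, lam, hlam, h3⟩
  set T : Set ℝ := {lam | 0 < lam ∧ ∀ x ∈ ball c lam \ {c}, u x ≤ kelvin c lam ν u x}
  set T' : Set ℝ := {lam | 0 < lam ∧ ∃ x ∈ ball c lam \ {c}, kelvin c lam ν u x < u x}
  -- The strict inequality on a compact core of the ball persists for nearby radii; the rest of the
  -- ball is a narrow region.
  have hT : IsOpen T := by
    rw [isOpen_iff_mem_nhds]
    rintro lam₀ ⟨hlam₀, hgood⟩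
    obtain ⟨δ, hδ, H⟩ := S.exists_narrow c (show 0 < lam₀ + 1 by linarith)
    obtain ⟨r, hr0, hr1, hvol⟩ := exists_small_shell c lam₀ hδ
    have hK : IsCompact (closedBall c (lam₀ - r) \ ball c r) :=
      (isCompact_closedBall c _).diff isOpen_ball
    have hev : ∀ᶠ lam in 𝓝 lam₀, ∀ x ∈ closedBall c (lam₀ - r) \ ball c r,
        u x < kelvin c lam ν u x := by
      refine hK.eventually_forall_of_forall_eventually fun x hx => ?_
      have hxc : x ≠ c := by
        rintro rfl
        exact hx.2 (mem_ball_self hr0)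
      have hxB : x ∈ ball c lam₀ \ {c} := by
        refine ⟨?_, hxc⟩
        have := hx.1
        rw [mem_closedBall] at this
        rw [mem_ball]
        linarith
      exact (S.cont.comp continuous_snd).continuousAt.eventually_lt
        (continuousAt_kelvin ν hlam₀ hxc S.cont) (hstrict lam₀ hlam₀ hgood x hxB)
    filter_upwards [hev, lt_mem_nhds hlam₀, gt_mem_nhds (show lam₀ < lam₀ + r by linarith)]
      with lam h1 h2 h3
    refine ⟨h2, H lam h2 (by linarith)
      (ball c lam \ (closedBall c (lam₀ - r) \ ball c r))
      (measurableSet_ball.diff (measurableSet_closedBall.diff measurableSet_ball))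
      sdiff_subset ((measure_mono (sdiff_le_sdiff_right (ball_subset_ball h3.le))).trans_lt hvol)
      fun x hx hxN => ?_⟩
    by_cases hxK : x ∈ closedBall c (lam₀ - r) \ ball c r
    · exact (h1 x hxK).le
    · exact absurd ⟨hx.1, hxK⟩ hxN
  have hT' : IsOpen T' := by
    rw [isOpen_iff_mem_nhds]
    rintro lam₀ ⟨hlam₀, x, hx, hlt⟩
    have h1 : ContinuousAt (fun lam : ℝ => kelvin c lam ν u x) lam₀ :=
      (continuousAt_kelvin ν hlam₀ hx.2 S.cont).comp (f := fun lam : ℝ => (lam, x)) (by fun_prop)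
    filter_upwards [lt_mem_nhds hlam₀, lt_mem_nhds (show dist x c < lam₀ from hx.1),
      h1.eventually_lt continuousAt_const hlt] with lam h2 h3 h4
    exact ⟨h2, x, ⟨h3, hx.2⟩, h4⟩
  have hdisj : Disjoint T T' := by
    rw [Set.disjoint_left]
    rintro lam ⟨-, h1⟩ ⟨-, x, hx, h2⟩
    exact absurd (h1 x hx) (not_le.2 h2)
  have hcov : Ioi (0 : ℝ) ⊆ T ∪ T' := by
    intro lam hlam
    by_cases h : ∀ x ∈ ball c lam \ {c}, u x ≤ kelvin c lam ν u x
    · exact Or.inl ⟨hlam, h⟩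
    · push Not at h
      exact Or.inr ⟨hlam, h⟩
  -- A ball of small radius is itself a narrow region.
  have hstart : (Ioi (0 : ℝ) ∩ T).Nonempty := by
    obtain ⟨δ, hδ, H⟩ := S.exists_narrow c one_pos
    have hlim := tendsto_measure_biInter_gt (μ := volume) (a := (0 : ℝ))
      (s := fun r => ball c r) (fun r _ => measurableSet_ball.nullMeasurableSet)
      (fun i j _ hij => ball_subset_ball hij) ⟨1, one_pos, measure_ball_lt_top.ne⟩
    have h0 : volume (⋂ r, ⋂ (_ : r > (0 : ℝ)), ball c r) = 0 := by
      refine measure_mono_null (t := {c}) (fun x hx => ?_) (measure_singleton c)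
      simp only [mem_iInter, mem_ball] at hx
      by_contra hne
      exact lt_irrefl _ (hx _ (dist_pos.2 hne))
    rw [h0] at hlim
    obtain ⟨r, hr3, hr1, hr2⟩ := ((hlim.eventually_lt_const hδ).and
      (Ioo_mem_nhdsGT (show (0 : ℝ) < 1 from one_pos))).exists
    exact ⟨r, hr1, hr1, H r hr1 hr2.le (ball c r) measurableSet_ball subset_rfl hr3
      fun x hx hxN => absurd hx.1 hxN⟩
  intro lam hlam
  exact (isPreconnected_Ioi.subset_left_of_subset_union hT hT' hdisj hcov hstart hlam).2

/-- If no moving sphere ever stops, then `u` is constant: any two points are exchanged by an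
inversion whose centre is far out on the line through them. -/
lemma le_of_forall_le_kelvin
    (h : ∀ c lam, 0 < lam → ∀ x ∈ ball c lam \ {c}, u x ≤ kelvin c lam ν u x)
    (x y : EuclideanSpace ℝ (Fin n)) : u y ≤ u x := by
  rcases eq_or_ne x y with rfl | hxy
  · exact le_rfl
  have hd : 0 < ‖y - x‖ := norm_pos_iff.2 (sub_ne_zero.2 hxy.symm)
  have key : ∀ t : ℝ, 0 < t → u y ≤ (√((1 + t⁻¹))) ^ ν * u x := by
    intro t ht
    set c := y + t • (y - x) with hc
    set lam := √(t * (1 + t)) * ‖y - x‖ with hlam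
    have hl : 0 < lam := by positivity
    have hdy : dist y c = t * ‖y - x‖ := by
      rw [dist_eq_norm, hc, sub_add_cancel_left, norm_neg, norm_smul, Real.norm_of_nonneg ht.le]
    have hl2 : lam ^ 2 = t * (1 + t) * ‖y - x‖ ^ 2 := by
      rw [hlam, mul_pow, Real.sq_sqrt (by positivity)]
    have hB : y ∈ ball c lam \ {c} := by
      refine ⟨?_, ?_⟩
      · rw [mem_ball, hdy]
        refine lt_of_pow_lt_pow_left₀ 2 hl.le ?_
        rw [hl2]
        have : 0 < t * ‖y - x‖ ^ 2 := by positivity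
        linarith
      · exact dist_pos.1 (hdy ▸ by positivity)
    have hinv : inversion c lam y = x := by
      rw [inversion, hdy, vsub_eq_sub, vadd_eq_add, div_pow, hl2, hc, sub_add_cancel_left,
        show t * (1 + t) * ‖y - x‖ ^ 2 / (t * ‖y - x‖) ^ 2 = (1 + t) / t by field_simp,
        smul_neg, smul_smul, show (1 + t) / t * t = 1 + t by field_simp]
      module
    have h1 := h c lam hl y hB
    rw [kelvin, hinv, hdy] at h1
    have h2 : lam / (t * ‖y - x‖) = √(1 + t⁻¹) := by
      rw [eq_comm, Real.sqrt_eq_iff_mul_self_eq (by positivity) (by positivity), ← sq, div_pow, hl2]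
      field_simp
      ring
    rwa [h2] at h1
  have hlim : Tendsto (fun t : ℝ => (√((1 + t⁻¹))) ^ ν * u x) atTop (𝓝 ((√(1 + 0)) ^ ν * u x)) := by
    refine Tendsto.mul_const _ (Tendsto.rpow_const ?_ (Or.inl (by simp)))
    exact (tendsto_inv_atTop_zero.const_add 1).sqrt
  have := ge_of_tendsto hlim ((eventually_gt_atTop 0).mono key)
  simpa using this

lemma not_forall_le_kelvin [Nonempty (Fin n)] (S : HartreeSystem ν σ p q R u v) :
    ¬ ∀ c lam, 0 < lam → ∀ x ∈ ball c lam \ {c}, u x ≤ kelvin c lam ν u x := by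
  intro h
  have hconst : ∀ y, u y = u 0 := fun y =>
    le_antisymm (le_of_forall_le_kelvin h 0 y) (le_of_forall_le_kelvin h y 0)
  have h1 := S.eq_v 0
  have hp : 0 < u 0 ^ p := Real.rpow_pos_of_pos (S.pos 0) p
  simp only [rieszPot, hconst] at h1
  rw [lintegral_congr fun y => ENNReal.ofReal_mul (by positivity),
    lintegral_mul_const _ (by fun_prop), lintegral_norm_sub_rpow_eq_top S.σ_lt S.σ_pos,
    ENNReal.top_mul (ENNReal.ofReal_pos.2 hp).ne'] at h1
  exact ENNReal.ofReal_ne_top h1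

lemma eq_kelvin_of_eq_on_ball {c : EuclideanSpace ℝ (Fin n)} {lam : ℝ} (hlam : 0 < lam)
    (h : ∀ x ∈ ball c lam \ {c}, u x = kelvin c lam ν u x) (x : EuclideanSpace ℝ (Fin n))
    (hx : x ≠ c) : u x = kelvin c lam ν u x := by
  have hd : 0 < dist x c := dist_pos.2 hx
  rcases lt_trichotomy (dist x c) lam with hlt | heq | hgt
  · exact h x ⟨hlt, hx⟩
  · rw [kelvin, inversion_of_mem_sphere heq, heq, div_self hlam.ne', Real.one_rpow, one_mul]
  · have hy : inversion c lam x ∈ ball c lam \ {c} := by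
      refine ⟨?_, ?_⟩
      · rw [mem_ball, dist_inversion_center, div_lt_iff₀ hd]; nlinarith
      · rw [mem_singleton_iff, inversion_eq_center hlam.ne']; exact hx
    have h1 := h _ hy
    rw [kelvin, inversion_inversion c hlam.ne', dist_inversion_center] at h1
    rw [kelvin, h1, ← mul_assoc, ← Real.mul_rpow (by positivity) (by positivity),
      show lam / dist x c * (lam / (lam ^ 2 / dist x c)) = 1 by field_simp, Real.one_rpow, one_mul]

/-- There is a sphere of symmetry of `u` around every point. One such sphere exists because the
moving spheres cannot all go on forever; it bounds `|x|^ν u(x)` at infinity, and this bound stops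
the moving spheres around every other point. -/
lemma exists_eq_kelvin [Nonempty (Fin n)] (S : HartreeSystem ν σ p q R u v)
    (c : EuclideanSpace ℝ (Fin n)) :
    ∃ lam, 0 < lam ∧ ∀ x, x ≠ c → u x = kelvin c lam ν u x := by
  obtain ⟨c₁, lam₁, hlam₁, h₁⟩ : ∃ c₁ lam₁, 0 < lam₁ ∧
      ∀ x, x ≠ c₁ → u x = kelvin c₁ lam₁ ν u x := by
    by_contra hne
    refine S.not_forall_le_kelvin fun c => (S.le_kelvin_or_eq_kelvin c).resolve_right ?_
    rintro ⟨-, -, lam, hlam, h⟩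
    exact hne ⟨c, lam, hlam, eq_kelvin_of_eq_on_ball hlam h⟩
  rcases S.le_kelvin_or_eq_kelvin c with h | ⟨-, -, lam, hlam, h⟩
  swap
  · exact ⟨lam, hlam, eq_kelvin_of_eq_on_ball hlam h⟩
  exfalso
  have hν := S.ν_pos
  obtain ⟨M, hM⟩ := (isCompact_closedBall c₁ lam₁).exists_bound_of_continuousOn S.cont.continuousOn
  have hdecay : ∀ x, lam₁ ≤ dist x c₁ → dist x c₁ ^ ν * u x ≤ lam₁ ^ ν * M := by
    intro x hx
    have hd : 0 < dist x c₁ := hlam₁.trans_le hx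
    have h2 : u (inversion c₁ lam₁ x) ≤ M := by
      refine (le_abs_self _).trans (hM _ ?_)
      rw [mem_closedBall, dist_inversion_center, div_le_iff₀ hd]
      nlinarith
    rw [h₁ x (dist_pos.1 hd), kelvin, Real.div_rpow hlam₁.le hd.le, ← mul_assoc,
      mul_div_cancel₀ _ (by positivity)]
    gcongr
  obtain ⟨y, hy⟩ := exists_ne c
  have hdy : 0 < dist y c := dist_pos.2 hy
  -- For a fixed `y` the inverse points escape to infinity as the radius grows, and there `u` would
  -- exceed its decay bound.
  have hev : ∀ᶠ lam : ℝ in atTop, 0 < lam ∧ dist y c < lam ∧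
      2 * dist c c₁ + lam₁ ≤ lam * lam / dist y c ∧ 2 ^ ν * (lam₁ ^ ν * M) < lam ^ ν * u y := by
    refine (eventually_gt_atTop 0).and ((eventually_gt_atTop _).and (.and ?_ ?_))
    · exact ((tendsto_id.atTop_mul_atTop₀ tendsto_id).atTop_div_const hdy).eventually_ge_atTop _
    · exact ((tendsto_rpow_atTop hν).atTop_mul_const (S.pos y)).eventually_gt_atTop _
  obtain ⟨lam, hlam, hylam, hfar, hbig⟩ := hev.exists
  have h2 := h lam hlam y ⟨hylam, hy⟩
  set x := inversion c lam y with hx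
  have hdx : dist x c = lam * lam / dist y c := by rw [hx, dist_inversion_center, sq]
  rw [← hdx] at hfar
  have h3 : dist x c ≤ dist x c₁ + dist c c₁ := dist_triangle_right _ _ _
  have h4 : (0 : ℝ) ≤ dist c c₁ := dist_nonneg
  have h5 := hdecay x (by linarith)
  have h6 : lam ^ ν * u y ≤ dist x c ^ ν * u x := by
    calc lam ^ ν * u y ≤ lam ^ ν * kelvin c lam ν u y := by gcongr
      _ = dist x c ^ ν * u x := by
        rw [kelvin, ← hx, ← mul_assoc, ← Real.mul_rpow hlam.le (by positivity), hdx, mul_div_assoc]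
  have h7 : dist x c ^ ν * u x ≤ (2 * dist x c₁) ^ ν * u x := by
    have := (S.pos x).le
    gcongr
    linarith
  rw [Real.mul_rpow (by norm_num) dist_nonneg, mul_assoc] at h7
  have h8 : (2 : ℝ) ^ ν * (dist x c₁ ^ ν * u x) ≤ 2 ^ ν * (lam₁ ^ ν * M) := by gcongr
  linarith

end HartreeSystem

end MovingSpheres

/-! ### Functions symmetric in a sphere around every point -/

section Rigidity

open Set Metric EuclideanGeometry Filter Topology

/-- A continuous positive solution of the functional equation expressing symmetry in spheres of
squared radius `f a` around every point `a` is a translate of `d + |x|²`. No differentiability is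
needed: applying the equation with the minimum point `m` of `f` shows that `g = f - |· - m|²`
satisfies `g x - g y ≥ -|x - y|²`, so `g` is constant. -/
theorem eq_norm_sub_sq_add_of_inversion_invariant {E : Type*} [NormedAddCommGroup E]
    [InnerProductSpace ℝ E] [FiniteDimensional ℝ E] {f : E → ℝ} (hf : Continuous f)
    (hpos : ∀ x, 0 < f x)
    (hinv : ∀ a b, b ≠ a → f a * f b = ‖b - a‖ ^ 2 * f (inversion a (√(f a)) b)) :
    ∃ m d, 0 < d ∧ ∀ x, f x = ‖x - m‖ ^ 2 + d := by
  have := FiniteDimensional.proper ℝ E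
  obtain ⟨m, hm⟩ : ∃ m, ∀ x, f m ≤ f x := by
    refine hf.exists_forall_le' 0 ?_
    obtain ⟨z, -, hz⟩ := (isCompact_closedBall (0 : E) 1).exists_isMinOn
      ⟨0, mem_closedBall_self zero_le_one⟩ hf.continuousOn
    have h0 := hpos 0
    have hz0 := hpos z
    filter_upwards [(tendsto_norm_cocompact_atTop (E := E)).eventually_ge_atTop (f 0),
      (tendsto_norm_cocompact_atTop (E := E)).eventually_ge_atTop (f 0 / f z),
      (tendsto_norm_cocompact_atTop (E := E)).eventually_gt_atTop 0] with b h1 h2 h3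
    have h5 := hinv 0 b (norm_pos_iff.1 h3)
    have h6 : f z ≤ f (inversion 0 (√(f 0)) b) := by
      refine hz ?_
      rw [mem_closedBall, dist_inversion_center, Real.sq_sqrt h0.le, dist_zero_right,
        div_le_one h3]
      exact h1
    rw [sub_zero] at h5
    rw [div_le_iff₀ hz0] at h2
    have h7 : f 0 * f 0 ≤ f 0 * f b := by
      rw [h5]
      calc f 0 * f 0 ≤ ‖b‖ * (‖b‖ * f z) := by gcongr
        _ = ‖b‖ ^ 2 * f z := by ring
        _ ≤ _ := by gcongr
    exact le_of_mul_le_mul_left h7 h0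
  have hquad : ∀ b, ‖b - m‖ ^ 2 ≤ f b := by
    intro b
    rcases eq_or_ne b m with rfl | hb
    · simpa using (hpos b).le
    · have h1 := hinv m b hb
      refine le_of_mul_le_mul_left ?_ (hpos m)
      rw [h1, mul_comm]
      gcongr
      exact hm _
  -- The previous bound at `b = a + f(a) h / |h|²`, the inverse point of `a + h`.
  have hlow : ∀ a h : E, f a + 2 * inner ℝ (a - m) h ≤ f (a + h) := by
    intro a h
    rcases eq_or_ne h 0 with rfl | hh
    · simp
    have hh' : 0 < ‖h‖ := norm_pos_iff.2 hh
    have ha := hpos a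
    set t := f a / ‖h‖ ^ 2 with ht
    have ht0 : 0 < t := by positivity
    have h1 := hinv a (a + t • h) (by simp [hh, ht0.ne'])
    have h2 : inversion a (√(f a)) (a + t • h) = a + h := by
      rw [inversion, dist_eq_norm, vsub_eq_sub, vadd_eq_add, add_sub_cancel_left, norm_smul,
        Real.norm_of_nonneg ht0.le, div_pow, Real.sq_sqrt ha.le, smul_smul, add_comm a]
      have : f a / (t * ‖h‖) ^ 2 * t = 1 := by rw [ht]; field_simp
      rw [this, one_smul]
    rw [h2, add_sub_cancel_left, norm_smul, Real.norm_of_nonneg ht0.le] at h1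
    have h3 := hquad (a + t • h)
    rw [add_sub_right_comm, norm_add_sq_real, inner_smul_right, norm_smul,
      Real.norm_of_nonneg ht0.le] at h3
    have h4 : f (a + t • h) = t * f (a + h) := by
      refine mul_left_cancel₀ ha.ne' ?_
      rw [h1, ht]; field_simp
    have h5 : t * ‖h‖ ^ 2 = f a := by rw [ht]; field_simp
    refine le_of_mul_le_mul_left ?_ ht0
    rw [← h4]
    have h6 : (t * ‖h‖) ^ 2 = t * f a := by rw [← h5]; ring
    nlinarith [sq_nonneg ‖a - m‖]
  set g : E → ℝ := fun x => f x - ‖x - m‖ ^ 2 with hg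
  have hle : ∀ x y, g y - ‖x - y‖ ^ 2 ≤ g x := by
    intro x y
    have h1 := hlow y (x - y)
    rw [add_sub_cancel] at h1
    have h2 : ‖x - m‖ ^ 2 = ‖y - m‖ ^ 2 + 2 * inner ℝ (y - m) (x - y) + ‖x - y‖ ^ 2 := by
      rw [← norm_add_sq_real]; congr 2; abel
    simp only [hg]
    linarith
  have hderiv : ∀ y, HasFDerivAt g (0 : E →L[ℝ] ℝ) y := by
    intro y
    have h1 : (fun x => g x - g y) =O[𝓝 y] fun x => ‖x - y‖ ^ 2 := by
      refine Asymptotics.IsBigO.of_bound 1 (Eventually.of_forall fun x => ?_)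
      have h2 := hle x y
      have h3 := hle y x
      rw [norm_sub_rev] at h3
      rw [Real.norm_eq_abs, Real.norm_of_nonneg (by positivity), abs_le]
      constructor <;> linarith
    simpa using (h1.hasFDerivAt one_lt_two).add_const (g y)
  have hconst : ∀ x, g x = g m := fun x =>
    is_const_of_fderiv_eq_zero (𝕜 := ℝ) (fun y => (hderiv y).differentiableAt)
      (fun y => (hderiv y).fderiv) x m
  refine ⟨m, f m, hpos m, fun x => ?_⟩
  have := hconst x
  simp only [hg, sub_self, norm_zero] at this
  linarith

variable {n : ℕ}

lemma tendsto_dist_rpow_mul {ν : ℝ} {u : EuclideanSpace ℝ (Fin n) → ℝ}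
    (hu : Continuous u) {c : EuclideanSpace ℝ (Fin n)} {lam : ℝ} (hlam : 0 < lam)
    (h : ∀ x, x ≠ c → u x = kelvin c lam ν u x) :
    Tendsto (fun x => dist x c ^ ν * u x) (Bornology.cobounded _) (𝓝 (lam ^ ν * u c)) := by
  have hd : Tendsto (fun x => dist x c) (Bornology.cobounded _) atTop :=
    tendsto_dist_right_cobounded_atTop c
  have hi : Tendsto (fun x => inversion c lam x) (Bornology.cobounded _) (𝓝 c) := by
    rw [tendsto_iff_dist_tendsto_zero]
    simp only [dist_inversion_center]
    exact hd.const_div_atTop _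
  refine (((hu.tendsto c).comp hi).const_mul (lam ^ ν)).congr' ?_
  filter_upwards [hd.eventually_gt_atTop 0] with x hx
  rw [Function.comp_apply, h x (dist_pos.1 hx), kelvin, Real.div_rpow hlam.le hx.le, ← mul_assoc,
    mul_div_cancel₀ _ (by positivity)]

/-- Both sides are the limit of `|x|^ν u(x)` at infinity. -/
lemma rpow_mul_eq_of_eq_kelvin [Nonempty (Fin n)] {ν : ℝ}
    {u : EuclideanSpace ℝ (Fin n) → ℝ} (hu : Continuous u) {a b : EuclideanSpace ℝ (Fin n)}
    {lam μ : ℝ} (hlam : 0 < lam) (hμ : 0 < μ) (ha : ∀ x, x ≠ a → u x = kelvin a lam ν u x)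
    (hb : ∀ x, x ≠ b → u x = kelvin b μ ν u x) : lam ^ ν * u a = μ ^ ν * u b := by
  have h1 := tendsto_dist_rpow_mul hu hlam ha
  have h2 := tendsto_dist_rpow_mul hu hμ hb
  have hd : Tendsto (fun x : EuclideanSpace ℝ (Fin n) => dist x b) (Bornology.cobounded _) atTop :=
    tendsto_dist_right_cobounded_atTop b
  have hratio : Tendsto (fun x : EuclideanSpace ℝ (Fin n) => dist x a / dist x b)
      (Bornology.cobounded _) (𝓝 1) := by
    rw [tendsto_iff_dist_tendsto_zero]
    refine squeeze_zero' (Eventually.of_forall fun x => dist_nonneg) ?_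
      (hd.const_div_atTop (dist a b))
    filter_upwards [hd.eventually_gt_atTop 0] with x hx
    rw [Real.dist_eq, div_sub_one hx.ne', abs_div, abs_of_pos hx]
    gcongr
    rw [dist_comm x a, dist_comm x b]
    exact abs_dist_sub_le a b x
  have h3 : Tendsto (fun x => dist x a ^ ν * u x) (Bornology.cobounded _)
      (𝓝 (1 ^ ν * (μ ^ ν * u b))) := by
    refine ((hratio.rpow_const (Or.inl one_ne_zero)).mul h2).congr' ?_
    filter_upwards [hd.eventually_gt_atTop 0] with x hx
    rw [Real.div_rpow dist_nonneg hx.le, ← mul_assoc, div_mul_cancel₀ _ (by positivity)]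
  rw [Real.one_rpow, one_mul] at h3
  exact tendsto_nhds_unique h1 h3

/-- A positive continuous function that is symmetric in some sphere around every point is a
bubble. -/
lemma eq_bubble_of_eq_kelvin [Nonempty (Fin n)] {ν : ℝ} (hν : 0 < ν)
    {u : EuclideanSpace ℝ (Fin n) → ℝ} (hu : Continuous u) (hpos : ∀ x, 0 < u x)
    (h : ∀ c, ∃ lam, 0 < lam ∧ ∀ x, x ≠ c → u x = kelvin c lam ν u x) :
    ∃ α d m, 0 < α ∧ 0 < d ∧ ∀ x, u x = α * (d + ‖x - m‖ ^ 2) ^ (-(ν / 2)) := by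
  choose lam hlam hsymm using h
  set α := lam 0 ^ ν * u 0 with hα
  have hα0 : 0 < α := mul_pos (Real.rpow_pos_of_pos (hlam 0) ν) (hpos 0)
  have hlamα : ∀ a, lam a ^ ν * u a = α := fun a =>
    rpow_mul_eq_of_eq_kelvin hu (hlam a) (hlam 0) (hsymm a) (hsymm 0)
  set f : EuclideanSpace ℝ (Fin n) → ℝ := fun x => (α / u x) ^ (2 / ν) with hf
  have hfpos : ∀ x, 0 < f x := fun x => Real.rpow_pos_of_pos (div_pos hα0 (hpos x)) _
  have hlamf : ∀ a, f a = lam a ^ 2 := by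
    intro a
    have h1 : α / u a = lam a ^ ν := by rw [← hlamα a, mul_div_cancel_right₀ _ (hpos a).ne']
    simp only [hf]
    rw [h1, ← Real.rpow_mul (hlam a).le, mul_div_cancel₀ _ hν.ne', Real.rpow_two]
  have hcont : Continuous f := by
    refine Continuous.rpow_const (continuous_const.div hu fun x => (hpos x).ne') fun x => Or.inl ?_
    exact (div_pos hα0 (hpos x)).ne'
  obtain ⟨m, d, hd, hfm⟩ := eq_norm_sub_sq_add_of_inversion_invariant hcont hfpos fun a b hab => by
    have h1 := hsymm a b hab
    have hdist : 0 < dist b a := dist_pos.2 hab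
    have hla := hlam a
    have h2 : √(f a) = lam a := by rw [hlamf, Real.sqrt_sq hla.le]
    rw [h2, ← dist_eq_norm, hlamf a]
    simp only [hf]
    have hp := hpos (inversion a (lam a) b)
    rw [h1, kelvin]
    have h3 : α / ((lam a / dist b a) ^ ν * u (inversion a (lam a) b)) =
        ((lam a / dist b a) ^ ν)⁻¹ * (α / u (inversion a (lam a) b)) := by field_simp
    rw [h3, Real.mul_rpow (by positivity) (by positivity), Real.inv_rpow (by positivity),
      ← Real.rpow_mul (by positivity), mul_div_cancel₀ _ hν.ne', Real.rpow_two]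
    field_simp
  refine ⟨α, d, m, hα0, hd, fun x => ?_⟩
  have hux := hpos x
  have h1 : (f x) ^ (-(ν / 2)) = u x / α := by
    simp only [hf]
    rw [← Real.rpow_mul (by positivity), show 2 / ν * -(ν / 2) = -1 by field_simp, Real.rpow_neg_one,
      inv_div]
  rw [add_comm d, ← hfm x, h1, mul_div_cancel₀ _ hα0.ne']

end Rigidity

/-! ### Riesz potentials of bubbles -/

section Bubble

open Set Metric EuclideanGeometry

lemma lintegral_rpow_mul_exp {a r : ℝ} (ha : 0 < a) (hr : 0 < r) :
    ∫⁻ t in Ioi (0 : ℝ), ENNReal.ofReal (t ^ (a - 1) * Real.exp (-(r * t))) =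
      ENNReal.ofReal ((1 / r) ^ a * Real.Gamma a) := by
  have h := Real.integral_rpow_mul_exp_neg_mul_Ioi ha hr
  have hpos : 0 < (1 / r) ^ a * Real.Gamma a :=
    mul_pos (by positivity) (Real.Gamma_pos_of_pos ha)
  rw [← h, ofReal_integral_eq_lintegral_ofReal]
  · by_contra hne
    rw [integral_undef hne] at h
    linarith
  · filter_upwards [ae_restrict_mem measurableSet_Ioi] with t ht
    have : 0 < t := ht
    positivity

variable {n : ℕ}

lemma lintegral_exp_neg_mul_norm_sq {t : ℝ} (ht : 0 < t) :
    ∫⁻ w : EuclideanSpace ℝ (Fin n), ENNReal.ofReal (Real.exp (-t * ‖w‖ ^ 2)) =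
      ENNReal.ofReal ((Real.pi / t) ^ ((n : ℝ) / 2)) := by
  have h := GaussianFourier.integral_rexp_neg_mul_sq_norm (V := EuclideanSpace ℝ (Fin n)) ht
  rw [finrank_euclideanSpace_fin] at h
  have hpos : 0 < (Real.pi / t) ^ ((n : ℝ) / 2) := by positivity
  rw [← h, ofReal_integral_eq_lintegral_ofReal]
  · by_contra hne
    rw [integral_undef hne] at h
    linarith
  · exact Filter.Eventually.of_forall fun w => (Real.exp_pos _).le

/-- Evaluated by writing the integrand as a superposition of Gaussians. -/
lemma lintegral_add_norm_sq_rpow {d a : ℝ} (hd : 0 < d) (ha : (n : ℝ) / 2 < a) :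
    ∫⁻ w : EuclideanSpace ℝ (Fin n), ENNReal.ofReal ((d + ‖w‖ ^ 2) ^ (-a)) =
      ENNReal.ofReal (Real.pi ^ ((n : ℝ) / 2) * Real.Gamma (a - n / 2) / Real.Gamma a *
        d ^ ((n : ℝ) / 2 - a)) := by
  have ha0 : 0 < a := lt_of_le_of_lt (by positivity) ha
  have hΓ : 0 < Real.Gamma a := Real.Gamma_pos_of_pos ha0
  have hΓ' : 0 < Real.Gamma (a - n / 2) := Real.Gamma_pos_of_pos (by linarith)
  have key : ENNReal.ofReal (Real.Gamma a) *
      ∫⁻ w : EuclideanSpace ℝ (Fin n), ENNReal.ofReal ((d + ‖w‖ ^ 2) ^ (-a)) =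
      ENNReal.ofReal (Real.pi ^ ((n : ℝ) / 2)) *
        ENNReal.ofReal ((1 / d) ^ (a - n / 2) * Real.Gamma (a - n / 2)) := by
    calc _ = ∫⁻ w : EuclideanSpace ℝ (Fin n), ∫⁻ t in Ioi (0 : ℝ),
          ENNReal.ofReal (t ^ (a - 1) * Real.exp (-((d + ‖w‖ ^ 2) * t))) := by
          rw [← lintegral_const_mul _ (by fun_prop)]
          refine lintegral_congr fun w => ?_
          rw [lintegral_rpow_mul_exp ha0 (by positivity), ← ENNReal.ofReal_mul hΓ.le, mul_comm,
            Real.rpow_neg (by positivity), one_div, Real.inv_rpow (by positivity)]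
      _ = ∫⁻ t in Ioi (0 : ℝ), ∫⁻ w : EuclideanSpace ℝ (Fin n),
          ENNReal.ofReal (t ^ (a - 1) * Real.exp (-((d + ‖w‖ ^ 2) * t))) := by
          rw [lintegral_lintegral_swap]
          fun_prop
      _ = ∫⁻ t in Ioi (0 : ℝ), ENNReal.ofReal (Real.pi ^ ((n : ℝ) / 2)) *
          ENNReal.ofReal (t ^ (a - n / 2 - 1) * Real.exp (-(d * t))) := by
          refine setLIntegral_congr_fun measurableSet_Ioi fun t ht => ?_
          have ht : 0 < t := ht
          have h1 : ∀ w : EuclideanSpace ℝ (Fin n),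
              ENNReal.ofReal (t ^ (a - 1) * Real.exp (-((d + ‖w‖ ^ 2) * t))) =
              ENNReal.ofReal (t ^ (a - 1) * Real.exp (-(d * t))) *
                ENNReal.ofReal (Real.exp (-t * ‖w‖ ^ 2)) := by
            intro w
            rw [← ENNReal.ofReal_mul (by positivity), mul_assoc, ← Real.exp_add]
            ring_nf
          beta_reduce
          rw [lintegral_congr h1, lintegral_const_mul _ (by fun_prop),
            lintegral_exp_neg_mul_norm_sq ht, ← ENNReal.ofReal_mul (by positivity),
            ← ENNReal.ofReal_mul (by positivity), Real.div_rpow Real.pi_pos.le ht.le,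
            show a - n / 2 - 1 = (a - 1) - n / 2 by ring, Real.rpow_sub ht (a - 1)]
          congr 1
          ring
      _ = _ := by
          rw [lintegral_const_mul _ (by fun_prop), lintegral_rpow_mul_exp (by linarith) hd]
  rw [← ENNReal.mul_right_inj (ENNReal.ofReal_pos.2 hΓ).ne' ENNReal.ofReal_ne_top, key,
    ← ENNReal.ofReal_mul (by positivity), ← ENNReal.ofReal_mul hΓ.le, one_div,
    Real.inv_rpow hd.le, ← Real.rpow_neg hd.le, neg_sub]
  congr 1
  field_simp

/-- The Riesz potential of a bubble, by inversion in the sphere with centre `x` and squared radius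
`d + |x - m|²`: it maps the singularity at `x` to infinity and preserves `d + |· - m|²` up to its
conformal factor. -/
lemma rieszPot_bubble [Nonempty (Fin n)] {d γ : ℝ} (hd : 0 < d) (hγn : γ < (n : ℝ) / 2)
    (m x : EuclideanSpace ℝ (Fin n)) :
    rieszPot (2 * γ) (fun y => (d + ‖y - m‖ ^ 2) ^ (-(n - γ))) x =
      ENNReal.ofReal (bubbleI n γ * d ^ (γ - (n : ℝ) / 2) * (d + ‖x - m‖ ^ 2) ^ (-γ)) := by
  set r := √(d + ‖x - m‖ ^ 2) with hr
  have hA : 0 < d + ‖x - m‖ ^ 2 := by positivity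
  have hr0 : 0 < r := Real.sqrt_pos.2 hA
  have hr2 : r ^ 2 = d + ‖x - m‖ ^ 2 := Real.sq_sqrt hA.le
  have hpt : ∀ w, w ≠ x → ENNReal.ofReal ((r / dist w x) ^ (2 * n)) *
      ENNReal.ofReal (‖x - inversion x r w‖ ^ (-(2 * γ)) *
        (d + ‖inversion x r w - m‖ ^ 2) ^ (-(n - γ))) =
      ENNReal.ofReal ((d + ‖x - m‖ ^ 2) ^ (-γ)) *
        ENNReal.ofReal ((d + ‖w - m‖ ^ 2) ^ (-(n - γ))) := by
    intro w hw
    have hz : 0 < dist w x := dist_pos.2 hw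
    have e1 : ‖x - inversion x r w‖ = r * (r / dist w x) := by
      rw [← dist_eq_norm, dist_center_inversion, dist_comm x w]; ring
    have e2 : d + ‖inversion x r w - m‖ ^ 2 = (r / dist w x) ^ 2 * (d + ‖w - m‖ ^ 2) := by
      have h1 : inversion x r w - m = (x - m) + (r / dist w x) ^ 2 • (w - x) := by
        rw [inversion, vsub_eq_sub, vadd_eq_add]; abel
      have h2 : w - m = (x - m) + (w - x) := by abel
      rw [h1, h2, norm_add_sq_real, norm_add_sq_real, inner_smul_right, norm_smul,
        Real.norm_of_nonneg (by positivity), ← dist_eq_norm w x]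
      have h3 : ((r / dist w x) ^ 2 * dist w x) ^ 2 = (r / dist w x) ^ 2 * r ^ 2 := by field_simp
      have h4 : (r / dist w x) ^ 2 * dist w x ^ 2 = r ^ 2 := by field_simp
      linear_combination h3 - h4 + ((r / dist w x) ^ 2 - 1) * hr2
    rw [← ENNReal.ofReal_mul (by positivity), ← ENNReal.ofReal_mul (by positivity), e1, e2, ← hr2]
    congr 1
    set ρ := r / dist w x
    have hρ : 0 < ρ := by positivity
    have hsq : ∀ {t : ℝ} (b : ℝ), 0 < t → (t ^ 2) ^ b = t ^ (2 * b) := fun b ht => by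
      rw [← Real.rpow_two, ← Real.rpow_mul ht.le]
    rw [Real.mul_rpow hr0.le hρ.le, Real.mul_rpow (by positivity) (by positivity),
      ← Real.rpow_natCast ρ (2 * n), hsq _ hρ, hsq _ hr0, show 2 * -γ = -(2 * γ) by ring]
    have h5 : ρ ^ ((2 * n : ℕ) : ℝ) * ρ ^ (-(2 * γ)) * ρ ^ (2 * -(n - γ)) = 1 := by
      rw [← Real.rpow_add hρ, ← Real.rpow_add hρ]
      push_cast
      rw [show (2 * n + -(2 * γ) + 2 * -(n - γ) : ℝ) = 0 by ring, Real.rpow_zero]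
    linear_combination (r ^ (-(2 * γ)) * (d + ‖w - m‖ ^ 2) ^ (-(n - γ))) * h5
  rw [rieszPot, lintegral_inversion (c := x) hr0, lintegral_congr_ae
    ((Measure.ae_ne volume x).mono hpt), lintegral_const_mul _ (by fun_prop),
    lintegral_sub_right_eq_self
      (fun w : EuclideanSpace ℝ (Fin n) => ENNReal.ofReal ((d + ‖w‖ ^ 2) ^ (-(n - γ)))) m,
    lintegral_add_norm_sq_rpow hd (by linarith), ← ENNReal.ofReal_mul (by positivity), bubbleI,
    show (n : ℝ) - γ - n / 2 = (n - 2 * γ) / 2 by ring,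
    show (n : ℝ) / 2 - (n - γ) = γ - n / 2 by ring, mul_comm]

lemma bubbleI_pos {γ : ℝ} (hγ : 0 < γ) (hγn : γ < (n : ℝ) / 2) : 0 < bubbleI n γ := by
  have h1 := Real.Gamma_pos_of_pos (show 0 < ((n : ℝ) - 2 * γ) / 2 by linarith)
  have h2 := Real.Gamma_pos_of_pos (show 0 < (n : ℝ) - γ by linarith)
  unfold bubbleI
  positivity

lemma rieszConst_pos {s : ℝ} (hs₀ : 0 < s) (hsn : s < (n : ℝ) / 2) : 0 < rieszConst (2 * s) n := by
  have h1 := Real.Gamma_pos_of_pos (show 0 < ((n : ℝ) - 2 * s) / 2 by linarith)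
  have h2 := Real.Gamma_pos_of_pos (show 0 < (2 * s) / 2 by linarith)
  unfold rieszConst
  positivity

lemma rieszPot_const_mul {κ a : ℝ} (ha : 0 ≤ a) (w : EuclideanSpace ℝ (Fin n) → ℝ)
    (x : EuclideanSpace ℝ (Fin n)) :
    rieszPot κ (fun y => a * w y) x = ENNReal.ofReal a * rieszPot κ w x := by
  rw [rieszPot, rieszPot, ← lintegral_const_mul' _ _ ENNReal.ofReal_ne_top]
  refine lintegral_congr fun y => ?_
  rw [← ENNReal.ofReal_mul ha]
  congr 1; ring

/-- The system determines the height of a bubble in terms of its width. -/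
lemma HartreeSystem.bubble_height [Nonempty (Fin n)] {ν σ p q R : ℝ}
    {u v : EuclideanSpace ℝ (Fin n) → ℝ} (S : HartreeSystem ν σ p q R u v)
    (hp : ν * p = 2 * n - σ) (hq : ν * q = 2 * n - ν - σ) {α d : ℝ}
    {m : EuclideanSpace ℝ (Fin n)} (hα : 0 < α) (hd : 0 < d)
    (hu : ∀ x, u x = α * (d + ‖x - m‖ ^ 2) ^ (-(ν / 2))) :
    α = d ^ (ν / 4) * (1 / (R * bubbleI n (σ / 2) * bubbleI n (ν / 2))) ^
      (ν / (2 * (2 * n - ν - σ))) := by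
  have hν := S.ν_pos
  have hνn := S.ν_lt
  have hσ := S.σ_pos
  have hσn := S.σ_lt
  have hR := S.R_pos
  have hq0 := S.q_pos
  have hI₁ : 0 < bubbleI n (σ / 2) := bubbleI_pos (by linarith) (by linarith)
  have hI₂ : 0 < bubbleI n (ν / 2) := bubbleI_pos (by linarith) (by linarith)
  have hA : ∀ x, 0 < d + ‖x - m‖ ^ 2 := fun x => by positivity
  have hv : ∀ y, v y = α ^ p * (bubbleI n (σ / 2) * d ^ (σ / 2 - (n : ℝ) / 2)) *
      (d + ‖y - m‖ ^ 2) ^ (-(σ / 2)) := by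
    intro y
    have hAy := hA y
    have h1 : (fun y => u y ^ p) = fun y => α ^ p * (d + ‖y - m‖ ^ 2) ^ (-(n - σ / 2)) := by
      funext z
      have hAz := hA z
      rw [hu, Real.mul_rpow hα.le (by positivity), ← Real.rpow_mul hAz.le]
      congr 2; linear_combination -(1 / 2) * hp
    have h2 := S.eq_v y
    have h3 := rieszPot_bubble hd (show σ / 2 < (n : ℝ) / 2 by linarith) m y
    rw [mul_div_cancel₀ σ two_ne_zero] at h3
    rw [h1, rieszPot_const_mul (by positivity), h3, ← ENNReal.ofReal_mul (by positivity),
      ENNReal.ofReal_eq_ofReal_iff (S.v_pos y).le (by positivity)] at h2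
    rw [h2]
    ring
  set E := R * (α ^ p * (bubbleI n (σ / 2) * d ^ (σ / 2 - (n : ℝ) / 2)) * α ^ q) with hE
  have hE0 : 0 < E := by positivity
  have h1 : (fun y => R * (v y * u y ^ q)) = fun y => E * (d + ‖y - m‖ ^ 2) ^ (-(n - ν / 2)) := by
    funext z
    have hAz := hA z
    have h3 : (d + ‖z - m‖ ^ 2) ^ (-(n - ν / 2)) =
        (d + ‖z - m‖ ^ 2) ^ (-(σ / 2)) * (d + ‖z - m‖ ^ 2) ^ (-(ν / 2) * q) := by
      rw [← Real.rpow_add hAz]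
      congr 1; linear_combination (1 / 2) * hq
    rw [hv, hu, Real.mul_rpow hα.le (by positivity), ← Real.rpow_mul hAz.le, h3, hE]
    ring
  have h2 := S.eq_u m
  have h3 := rieszPot_bubble hd (show ν / 2 < (n : ℝ) / 2 by linarith) m m
  rw [mul_div_cancel₀ ν two_ne_zero] at h3
  rw [h1, rieszPot_const_mul hE0.le, h3, ← ENNReal.ofReal_mul (by positivity), hu,
    ENNReal.ofReal_eq_ofReal_iff (by positivity) (by positivity), sub_self, norm_zero,
    zero_pow two_ne_zero, add_zero, ← mul_assoc] at h2
  have h3 : α = E * (bubbleI n (ν / 2) * d ^ (ν / 2 - (n : ℝ) / 2)) :=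
    mul_right_cancel₀ (by positivity) h2
  set θ := 2 * n - ν - σ with hθ
  have hθ0 : 0 < θ := by rw [← hq]; positivity
  set K := R * bubbleI n (σ / 2) * bubbleI n (ν / 2) with hK
  have hK0 : 0 < K := by positivity
  have h4 : α = α ^ p * α ^ q * (K * d ^ (-(θ / 2))) := by
    have : d ^ (-(θ / 2)) = d ^ (σ / 2 - (n : ℝ) / 2) * d ^ (ν / 2 - (n : ℝ) / 2) := by
      rw [← Real.rpow_add hd]; congr 1; rw [hθ]; ring
    rw [this, hK]
    refine h3.trans ?_
    rw [hE]; ring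
  have h5 : α ^ (p + q - 1) = 1 / K * d ^ (θ / 2) := by
    rw [Real.rpow_sub hα, Real.rpow_add hα, Real.rpow_one]
    rw [Real.rpow_neg hd.le] at h4
    have : 0 < d ^ (θ / 2) := by positivity
    field_simp at h4 ⊢
    linarith
  have h6 : (p + q - 1) * (ν / (2 * θ)) = 1 := by
    rw [← mul_div_assoc, div_eq_one_iff_eq (by positivity)]
    linear_combination hp + hq - hθ
  calc α = (α ^ (p + q - 1)) ^ (ν / (2 * θ)) := by
        rw [← Real.rpow_mul hα.le, h6, Real.rpow_one]
    _ = _ := by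
        rw [h5, Real.mul_rpow (by positivity) (by positivity), ← Real.rpow_mul hd.le, mul_comm,
          show θ / 2 * (ν / (2 * θ)) = ν / 4 by field_simp; norm_num]

lemma bubble_eq_rescaled {s σ d : ℝ} (hd : 0 < d) (m x : EuclideanSpace ℝ (Fin n)) :
    d ^ (((n : ℝ) - 2 * s) / 4) *
      (1 / (rieszConst (2 * s) n * bubbleI n (σ / 2) * bubbleI n (((n : ℝ) - 2 * s) / 2))) ^
        (((n : ℝ) - 2 * s) / (2 * ((n : ℝ) + 2 * s - σ))) *
      (d + ‖x - m‖ ^ 2) ^ (-(((n : ℝ) - 2 * s) / 2)) =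
    (√d)⁻¹ ^ (((n : ℝ) - 2 * s) / 2) * bubbleQ n s σ ((√d)⁻¹ • (x - m)) := by
  set ν := (n : ℝ) - 2 * s
  have hA : 0 < d + ‖x - m‖ ^ 2 := by positivity
  have h1 : 1 / (1 + ‖(√d)⁻¹ • (x - m)‖ ^ 2) = d * (d + ‖x - m‖ ^ 2)⁻¹ := by
    rw [norm_smul, mul_pow, Real.norm_of_nonneg (by positivity), inv_pow, Real.sq_sqrt hd.le]
    field_simp
  have h2 : (√d)⁻¹ ^ (ν / 2) * d ^ (ν / 2) = d ^ (ν / 4) := by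
    rw [Real.sqrt_eq_rpow, ← Real.rpow_neg hd.le, ← Real.rpow_mul hd.le, ← Real.rpow_add hd]
    congr 1; ring
  rw [bubbleQ, h1, Real.mul_rpow hd.le (by positivity), Real.inv_rpow hA.le,
    ← Real.rpow_neg hA.le, ← h2]
  ring

end Bubble

/-! ### Classification -/

/-- A nontrivial solution forces both exponents to be critical. -/
lemma IsNonnegSolution.critical_of_ne_zero {n : ℕ} [Nonempty (Fin n)] {s σ p q : ℝ}
    (hs₀ : 0 < s) (hsn : s < (n : ℝ) / 2) (hσ₀ : 0 < σ) (hσn : σ < n)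
    (hp₀ : 0 < p) (hp : p ≤ (2 * (n : ℝ) - σ) / ((n : ℝ) - 2 * s))
    (hq₀ : 0 < q) (hq : q ≤ ((n : ℝ) + 2 * s - σ) / ((n : ℝ) - 2 * s))
    {u : EuclideanSpace ℝ (Fin n) → ℝ} (hu : Continuous u) (h : IsNonnegSolution s σ p q u)
    {x₁ : EuclideanSpace ℝ (Fin n)} (hx₁ : u x₁ ≠ 0) :
    p = (2 * (n : ℝ) - σ) / ((n : ℝ) - 2 * s) ∧
      q = ((n : ℝ) + 2 * s - σ) / ((n : ℝ) - 2 * s) := by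
  have S := h.hartreeSystem (rieszConst_pos hs₀ hsn) hs₀ hsn hσ₀ hσn hp₀ hp hq₀ hq hu hx₁
  obtain ⟨c, hc⟩ := not_forall.1 S.not_forall_le_kelvin
  obtain ⟨h1, h2, -⟩ := (S.le_kelvin_or_eq_kelvin c).resolve_left hc
  have hν := S.ν_pos
  rw [eq_div_iff hν.ne', eq_div_iff hν.ne']
  constructor <;> linarith

theorem theorem1p3 (n m : ℕ) (α s σ p q : ℝ) (hn : 1 ≤ n)
    (hα₀ : 0 < α) (hα₂ : α ≤ 2) (hs : s = m + α / 2) (hs₀ : 0 < s) (hsn : s < (n : ℝ) / 2)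
    (hσ₀ : 0 < σ) (hσn : σ < n)
    (hp₀ : 0 < p) (hp : p ≤ (2 * (n : ℝ) - σ) / ((n : ℝ) - 2 * s))
    (hq₀ : 0 < q) (hq : q ≤ ((n : ℝ) + 2 * s - σ) / ((n : ℝ) - 2 * s)) :
    (p = (2 * (n : ℝ) - σ) / ((n : ℝ) - 2 * s) →
      q = ((n : ℝ) + 2 * s - σ) / ((n : ℝ) - 2 * s) →
      ∀ u : EuclideanSpace ℝ (Fin n) → ℝ, Continuous u → IsNonnegSolution s σ p q u →
        (∀ x, u x = 0) ∨
        ∃ μ : ℝ, 0 < μ ∧ ∃ x₀ : EuclideanSpace ℝ (Fin n), ∀ x,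
          u x = μ ^ (((n : ℝ) - 2 * s) / 2) * bubbleQ n s σ (μ • (x - x₀))) ∧
    (p < (2 * (n : ℝ) - σ) / ((n : ℝ) - 2 * s) ∨
        q < ((n : ℝ) + 2 * s - σ) / ((n : ℝ) - 2 * s) →
      ∀ u : EuclideanSpace ℝ (Fin n) → ℝ, Continuous u →
        (IsNonnegSolution s σ p q u ↔ ∀ x, u x = 0)) := by
  have : Nonempty (Fin n) := ⟨⟨0, hn⟩⟩
  refine ⟨fun hp' hq' u hu h => ?_, fun hlt u hu => ⟨fun h => ?_, fun h => ⟨?_, ?_⟩⟩⟩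
  · by_cases hzero : ∀ x, u x = 0
    · exact Or.inl hzero
    right
    obtain ⟨x₁, hx₁⟩ := not_forall.1 hzero
    have S := h.hartreeSystem (rieszConst_pos hs₀ hsn) hs₀ hsn hσ₀ hσn hp₀ hp hq₀ hq hu hx₁
    have hν := S.ν_pos
    obtain ⟨a, d, x₀, ha, hd, hbub⟩ := eq_bubble_of_eq_kelvin hν hu S.pos S.exists_eq_kelvin
    have hheight := S.bubble_height
      (by rw [hp', mul_div_cancel₀ _ hν.ne'])
      (by rw [hq', mul_div_cancel₀ _ hν.ne']; ring) ha hd hbub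
    refine ⟨(√d)⁻¹, inv_pos.2 (Real.sqrt_pos.2 hd), x₀, fun x => ?_⟩
    rw [← bubble_eq_rescaled hd, hbub, hheight,
      show 2 * (n : ℝ) - (n - 2 * s) - σ = n + 2 * s - σ by ring]
  · by_contra hne
    obtain ⟨x₁, hx₁⟩ := not_forall.1 hne
    obtain ⟨h1, h2⟩ := h.critical_of_ne_zero hs₀ hsn hσ₀ hσn hp₀ hp hq₀ hq hu hx₁
    rcases hlt with hlt | hlt
    · exact hlt.ne h1
    · exact hlt.ne h2
  · intro x
    exact (h x).ge
  · intro x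
    simp [h, Real.zero_rpow hq₀.ne']
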